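/- Let $M\ge 1$ be an integer. For a real number $q>1$, an expansion of a real number $x$ in base $q$ is a sequence $(c_i)_{i\ge 1}\in\{0,1,\dots,M\}^{\mathbb N}$ with $(c_i)_q:=\sum_{i\ge 1}c_i q^{-i}=x$; the greedy expansion of $x$ is its lexicographically largest expansion. Let $\mathcal U$ be the set of bases $q\in(1,M+1]$ in which $x=1$ has exactly one expansion, and let $\overline{\mathcal U}$ be its topological closure. Let $q\in\overline{\mathcal U}\setminus\mathcal U$. Then the number $1$ has a greedy expansion in base $q$, and it is finite, say $\beta_1\cdots\beta_N\,0^\infty$ with $N\ge 1$ and $\beta_N\neq 0$. Put $$a_i:=(\beta_i\cdots\beta_N\,0^\infty)_q,\qquad b_i:=\frac{M}{q-1}-a_i\qquad(1\le i\le N),$$ $$\theta_j:=\frac jq,\qquad \eta_j:=\frac{j-1}{q}+\frac{M}{q^2-q}\qquad(1\le j\le M),\qquad S_q:=\bigcup_{j=1}^M[\theta_j,\eta_j].$$ Let $\mathcal G(q)$ be the labeled directed graph whose vertices are the connected components (open intervals) of $$\Bigl(0,\frac{M}{q-1}\Bigr)\setminus\bigl(S_q\cup\{a_1,\dots,a_N,b_1,\dots,b_N\}\bigr),$$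 and whose edges are the triplets $(I,k,J)$ with vertices $I,J$ and $k\in\{0,\dots,M\}$ such that $T_k(I)\supseteq J$, where $T_k(x)=qx-k$. Let $\tilde{\mathcal G}(q)$ be the subgraph of $\mathcal G(q)$ formed by the vertices contained in $(b_1,a_1)$, and let $\tilde{\mathcal G}_1(q)$ be the subgraph of $\tilde{\mathcal G}(q)$ formed by those vertices whose right endpoint belongs to $\{a_1,\dots,a_N\}$ or whose left endpoint belongs to $\{b_1,\dots,b_N\}$. A graph is called strongly connected if for every ordered pair $(I,J)$ of its vertices there is a (finite, possibly empty) path in the graph from $I$ to $J$. Then the graph $\tilde{\mathcal G}_1(q)$ is strongly connected. Moreover, the graph $\tilde{\mathcal G}(q)$ is strongly connected if and only if for every vertex $J$ of $\tilde{\mathcal G}(q)$ that is of the form $(a_i,b_j)$ with $1\le i,j\le N$, or whose right endpoint is $\theta_i$ for some $1\le i\le M$, there is a path in $\tilde{\mathcal G}(q)$ from some vertex of $\tilde{\mathcal G}_1(q)$ to $J$. -/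

import Mathlib

/-! Labeled directed graphs -/

/-- A directed graph with labeled edges; an edge is a triplet `(I, k, J)` from `I` to `J` with
label `k`. -/
structure LabeledGraph (V L : Type*) where
  verts : Set V
  edges : Set (V × L × V)
  edges_mem : ∀ e ∈ edges, e.1 ∈ verts ∧ e.2.2 ∈ verts

namespace LabeledGraph

variable {V L : Type*}

/-- The subgraph formed by the vertices that belong to `W`, with all edges between them. -/
def induce (G : LabeledGraph V L) (W : Set V) : LabeledGraph V L where
  verts := {I | I ∈ G.verts ∧ I ∈ W}
  edges := {e | e ∈ G.edges ∧ e.1 ∈ W ∧ e.2.2 ∈ W}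
  edges_mem := fun e he =>
    ⟨⟨(G.edges_mem e he.1).1, he.2.1⟩, ⟨(G.edges_mem e he.1).2, he.2.2⟩⟩

/-- There is a (finite, possibly empty) path of consecutive edges of `G` from `I` to `J`. -/
def HasPath (G : LabeledGraph V L) (I J : V) : Prop :=
  Relation.ReflTransGen (fun I' J' => ∃ k, (I', k, J') ∈ G.edges) I J

def StronglyConnected (G : LabeledGraph V L) : Prop :=
  ∀ I ∈ G.verts, ∀ J ∈ G.verts, G.HasPath I J

end LabeledGraph

/-! Expansions in a base `q > 1` over the alphabet `{0, …, M}`. A sequence `c₁c₂⋯` of digits is a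
function `c : ℕ → Fin (M + 1)`, where `c k` is the digit of index `k + 1`. -/

namespace Univoque

/-- `(c₁c₂⋯)_q = ∑_{i ≥ 1} c_i / q^i`. -/
noncomputable def value {M : ℕ} (q : ℝ) (c : ℕ → Fin (M + 1)) : ℝ :=
  ∑' k : ℕ, ((c k : ℕ) : ℝ) / q ^ (k + 1)

def IsExpansion {M : ℕ} (q x : ℝ) (c : ℕ → Fin (M + 1)) : Prop :=
  value q c = x

/-- The set of bases in which `1` has a unique expansion. -/
def univoqueBases (M : ℕ) : Set ℝ :=
  {q | 1 < q ∧ q ≤ M + 1 ∧ ∃! c : ℕ → Fin (M + 1), IsExpansion q 1 c}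

/-- The greedy expansion of `x` is its lexicographically largest expansion. -/
def IsGreedyExpansion {M : ℕ} (q x : ℝ) (b : ℕ → Fin (M + 1)) : Prop :=
  IsGreatest {w : Lex (ℕ → Fin (M + 1)) | IsExpansion q x (ofLex w)} (toLex b)

/-- The sequence is finite and its last nonzero digit is the one of index `N ≥ 1`. -/
def HasLastDigit {M : ℕ} (b : ℕ → Fin (M + 1)) (N : ℕ) : Prop :=
  1 ≤ N ∧ b (N - 1) ≠ 0 ∧ ∀ k, N ≤ k → b k = 0

section Graph

/-! In the following `b` stands for the greedy expansion of `1` in base `q`, and `N` is the index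
of its last nonzero digit. -/

variable {M : ℕ} (q : ℝ) (b : ℕ → Fin (M + 1)) (N : ℕ)

/-- The point `a_i = (b_i b_{i+1} ⋯)_q` for `i ≥ 1`. -/
noncomputable def aPt (i : ℕ) : ℝ :=
  value q (fun k => b (i - 1 + k))

/-- The point `b_i = M / (q - 1) - a_i` for `i ≥ 1`. -/
noncomputable def bPt (i : ℕ) : ℝ :=
  M / (q - 1) - aPt q b i

noncomputable def theta (j : ℕ) : ℝ := j / q

/-- The point `η_j` for `1 ≤ j`. -/
noncomputable def eta (M : ℕ) (q : ℝ) (j : ℕ) : ℝ :=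
  ((j : ℝ) - 1) / q + M / (q ^ 2 - q)

/-- The switch region `S_q`, the union of the intervals `[θ_j, η_j]` for `1 ≤ j ≤ M`. -/
def switchRegion (M : ℕ) (q : ℝ) : Set ℝ :=
  ⋃ j ∈ Set.Icc 1 M, Set.Icc (theta q j) (eta M q j)

/-- The open set whose connected components are the vertices of the univoque graph. -/
def vertexRegion : Set ℝ :=
  Set.Ioo 0 (M / (q - 1)) \
    (switchRegion M q ∪ aPt q b '' Set.Icc 1 N ∪ bPt q b '' Set.Icc 1 N)

/-- The univoque graph `𝒢(q)`: its vertices are the connected components of `vertexRegion`, its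
edges are the triplets `(I, k, J)` of vertices `I`, `J` and digits `k` such that `T_k(I) ⊇ J`,
where `T_k(x) = q x - k`. -/
def univoqueGraph : LabeledGraph (Set ℝ) (Fin (M + 1)) where
  verts := {I | ∃ x ∈ vertexRegion q b N, I = connectedComponentIn (vertexRegion q b N) x}
  edges := {e | (∃ x ∈ vertexRegion q b N, e.1 = connectedComponentIn (vertexRegion q b N) x) ∧
    (∃ y ∈ vertexRegion q b N, e.2.2 = connectedComponentIn (vertexRegion q b N) y) ∧
    e.2.2 ⊆ (fun x : ℝ => q * x - ((e.2.1 : ℕ) : ℝ)) '' e.1}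
  edges_mem := fun _ he => ⟨he.1, he.2.1⟩

/-- The subgraph of the univoque graph formed by the vertices that are subintervals of
`(b_1, a_1)`. -/
def tildeGraph : LabeledGraph (Set ℝ) (Fin (M + 1)) :=
  (univoqueGraph q b N).induce {I | I ⊆ Set.Ioo (bPt q b 1) (aPt q b 1)}

/-- The subgraph of `tildeGraph` formed by the vertices whose right endpoint is one of the points
`a_i` or whose left endpoint is one of the points `b_i`, with `1 ≤ i ≤ N`. -/
def tildeGraphOne : LabeledGraph (Set ℝ) (Fin (M + 1)) :=
  (tildeGraph q b N).induce
    {I | (∃ i ∈ Set.Icc 1 N, ∃ c, I = Set.Ioo c (aPt q b i)) ∨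
      (∃ i ∈ Set.Icc 1 N, ∃ d, I = Set.Ioo (bPt q b i) d)}

/-- The set `I` is of the form `(a_i, b_j)` with `1 ≤ i, j ≤ N`. -/
def IsABInterval (I : Set ℝ) : Prop :=
  ∃ i ∈ Set.Icc 1 N, ∃ j ∈ Set.Icc 1 N, I = Set.Ioo (aPt q b i) (bPt q b j)

/-- The set `I` is an open interval with right endpoint `θ_i` for some `1 ≤ i ≤ M`. -/
def IsThetaInterval (M : ℕ) (q : ℝ) (I : Set ℝ) : Prop :=
  ∃ i ∈ Set.Icc 1 M, ∃ c, I = Set.Ioo c (theta q i)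

end Graph

end Univoque

/-! In base `q` the remainders of the greedy expansion of `1` form the orbit `x_0 = 1`,
`x_{k+1} = q x_k - d_k`, and all of them after `x_0` are less than `1`. Put `L = M / (q - 1)`.
The expansion is unique precisely if `x_k > L - 1` for all `k ≥ 1`
(`lt_orbit_of_mem_univoqueBases`, `mem_univoqueBases_of_lt`). If `q` is not a univoque base, then
some `x_k < L - 1` (`exists_orbit_lt`): an orbit that only touches `L - 1` runs through the
reflections `x ↦ L - x` of its initial segment and ends in `0`. As long as the orbit avoids `0`, it
depends continuously on the base, so for `q` in the closure of the univoque bases the first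
`x_N < L - 1` has to be `0`: the greedy expansion is finite. The earlier remainders do not touch
`L - 1` either, because the nearby univoque bases share the digits of `q` except for lowering the
last one, and a touching would make these orbits leave the interval `[0, 1)`
(`exists_orbit_eq_zero_and_lt`).

Thus `a_i = x_{i-1}` satisfies `b_1 < a_i ≤ a_1 = 1` for `1 ≤ i ≤ N`, and the rest is a discussion
of endpoints (`IsFiniteGreedy`). The vertices are the intervals `(c, d)` in the vertex
region whose endpoints lie outside it; inside `(b_1, a_1)` the left endpoint is an `η_j`, or an `a_i` or
`b_i` with `i < N`, and symmetrically for the right one. Since `(b_1, a_1)` is shorter than `1`,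
there is one digit `k` that matters, and `T_k` sends `η_j`, `a_i`, `b_i` to `b_1`, `a_{i+1}`,
`b_{i+1}` and `θ_j` to `a_1` (`left_cases`, `right_cases`). Hence every vertex that meets the image
of a vertex is contained in it (`edge_of_overlap`).

The vertices with right endpoints `a_1, …, a_N` form a cycle, and so do those with left endpoints
`b_1, …, b_N`. The vertex below the smallest `a_i` starts at some `b_j` or `η_j`, which connects the
first cycle to the second; the reflection gives the way back (`stronglyConnected_one`). Every other
vertex leads to these cycles: at once if it starts at some `η_j` or ends at some `θ_j`, while the
images of `(a_i, b_j)` cannot stay of this form beyond `a_N` (`reachesOne`). The vertices that are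
not on the cycles are of the form `(a_i, b_j)`, end at some `θ_j`, or are the reflections of
vertices `(a_i, θ_j)`, whence the criterion (`stronglyConnected_iff`). -/

open Filter Topology

namespace Univoque

variable {M : ℕ} {q : ℝ}

/-! ### Values of digit sequences -/

theorem summable_value (hq : 1 < q) (c : ℕ → Fin (M + 1)) :
    Summable fun k : ℕ => ((c k : ℕ) : ℝ) / q ^ (k + 1) := by
  have hq0 : 0 < q := by linarith
  have hg : Summable fun k : ℕ => (M : ℝ) / q * (q⁻¹) ^ k :=
    (summable_geometric_of_lt_one (by positivity) (inv_lt_one_of_one_lt₀ hq)).mul_left _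
  refine Summable.of_nonneg_of_le (fun k => by positivity) (fun k => ?_) hg
  have h : ((c k : ℕ) : ℝ) ≤ M := by exact_mod_cast Nat.lt_succ_iff.mp (c k).isLt
  rw [inv_pow, pow_succ', ← div_eq_mul_inv, div_div]
  gcongr

theorem value_nonneg (hq : 1 < q) (c : ℕ → Fin (M + 1)) : 0 ≤ value q c :=
  tsum_nonneg fun k => by have : 0 < q := by linarith
                          positivity

theorem value_le (hq : 1 < q) (c : ℕ → Fin (M + 1)) : value q c ≤ M / (q - 1) := by
  have hq0 : 0 < q := by linarith
  have hg : HasSum (fun k : ℕ => (M : ℝ) / q * (q⁻¹) ^ k) (M / q * (1 - q⁻¹)⁻¹) :=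
    (hasSum_geometric_of_lt_one (by positivity) (inv_lt_one_of_one_lt₀ hq)).mul_left _
  have he : (M : ℝ) / q * (1 - q⁻¹)⁻¹ = M / (q - 1) := by
    have : q - 1 ≠ 0 := by linarith
    have : 1 - q⁻¹ = (q - 1) / q := by field_simp
    rw [this]
    field_simp
  rw [← he, ← hg.tsum_eq]
  refine (summable_value hq c).tsum_le_tsum (fun k => ?_) hg.summable
  have h : ((c k : ℕ) : ℝ) ≤ M := by exact_mod_cast Nat.lt_succ_iff.mp (c k).isLt
  rw [inv_pow, pow_succ', ← div_eq_mul_inv, div_div]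
  gcongr

theorem value_eq_sum_add (hq : 1 < q) (c : ℕ → Fin (M + 1)) (n : ℕ) :
    value q c = ∑ k ∈ Finset.range n, ((c k : ℕ) : ℝ) / q ^ (k + 1) +
      value q (fun k => c (n + k)) / q ^ n := by
  have hq0 : 0 < q := by linarith
  unfold value
  rw [← (summable_value hq c).sum_add_tsum_nat_add n, ← tsum_div_const]
  congr 1
  refine tsum_congr fun k => ?_
  rw [div_div, add_comm k n, ← pow_add]
  congr 2
  ring

theorem value_shift (hq : 1 < q) (c : ℕ → Fin (M + 1)) (n : ℕ) :
    value q (fun k => c (n + 1 + k)) = q * value q (fun k => c (n + k)) - (c n : ℕ) := by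
  have hq0 : 0 < q := by linarith
  have h := value_eq_sum_add hq (fun k => c (n + k)) 1
  have e : (fun k => c (n + 1 + k)) = fun k => c (n + (1 + k)) := by
    funext k; rw [add_assoc]
  rw [e, h]
  simp
  field_simp
  ring

/-- A bounded orbit `x` of the maps `x ↦ q x - c k` recovers `x 0` as the value of the digit
sequence `c`: after `n` digits the error is `x n / q ^ n`. -/
theorem value_eq_of_recurrence (hq : 1 < q) {c : ℕ → Fin (M + 1)} {x : ℕ → ℝ} {B : ℝ}
    (hx : ∀ k, x (k + 1) = q * x k - (c k : ℕ)) (hB : ∀ k, |x k| ≤ B) : value q c = x 0 := by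
  have hq0 : 0 < q := by linarith
  have hsum : ∀ n, ∑ k ∈ Finset.range n, ((c k : ℕ) : ℝ) / q ^ (k + 1) = x 0 - x n / q ^ n := by
    intro n
    induction n with
    | zero => simp
    | succ n ih =>
      rw [Finset.sum_range_succ, ih, hx n]
      field_simp
      ring
  have hz : Tendsto (fun n => x n / q ^ n) atTop (𝓝 0) := by
    have hB' : Tendsto (fun n : ℕ => B * (q⁻¹) ^ n) atTop (𝓝 0) := by
      simpa using (tendsto_pow_atTop_nhds_zero_of_lt_one (by positivity)
        (inv_lt_one_of_one_lt₀ hq)).const_mul B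
    refine squeeze_zero_norm (fun n => ?_) hB'
    rw [Real.norm_eq_abs, abs_div, abs_of_pos (pow_pos hq0 n), inv_pow, ← div_eq_mul_inv]
    gcongr
    exact hB n
  have ht := (summable_value hq c).hasSum.tendsto_sum_nat
  simp only [hsum] at ht
  have ht' : Tendsto (fun n => x 0 - x n / q ^ n) atTop (𝓝 (x 0 - 0)) :=
    tendsto_const_nhds.sub hz
  rw [sub_zero] at ht'
  exact tendsto_nhds_unique ht ht'

/-! ### The greedy algorithm -/

/-- The digit chosen by the greedy algorithm at `x`: the largest one not exceeding `q x`. -/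
noncomputable def greedyDigit (M : ℕ) (q x : ℝ) : Fin (M + 1) :=
  ⟨min M ⌊q * x⌋₊, Nat.lt_succ_of_le (min_le_left _ _)⟩

/-- The successive remainders of the greedy algorithm in base `q`, started at `x`. -/
noncomputable def greedyOrbit (M : ℕ) (q x : ℝ) : ℕ → ℝ
  | 0 => x
  | k + 1 => q * greedyOrbit M q x k - (greedyDigit M q (greedyOrbit M q x k) : ℕ)

theorem greedyOrbit_succ (M : ℕ) (q x : ℝ) (k : ℕ) : greedyOrbit M q x (k + 1) =
    q * greedyOrbit M q x k - (greedyDigit M q (greedyOrbit M q x k) : ℕ) := rfl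

theorem one_le_bound (hq : 1 < q) (hqM : q ≤ M + 1) : 1 ≤ M / (q - 1) := by
  rw [le_div_iff₀ (by linarith)]; linarith

theorem greedyOrbit_mem (hq : 1 < q) (hqM : q ≤ M + 1) {x : ℝ} (hx : x ∈ Set.Icc 0 (M / (q - 1)))
    (k : ℕ) : greedyOrbit M q x k ∈ Set.Icc 0 (M / (q - 1)) := by
  induction k with
  | zero => exact hx
  | succ k ih =>
    rw [greedyOrbit_succ]
    set y := greedyOrbit M q x k
    have hy : 0 ≤ q * y := mul_nonneg (by linarith) ih.1
    have hL := one_le_bound hq hqM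
    simp only [greedyDigit]
    rcases le_total ⌊q * y⌋₊ M with h | h
    · rw [min_eq_right h]
      have h1 := Nat.floor_le hy
      have h2 := Nat.lt_floor_add_one (q * y)
      constructor <;> linarith
    · rw [min_eq_left h]
      have h1 : (M : ℝ) ≤ q * y := (Nat.le_floor_iff hy).mp h
      have h2 : q * (M / (q - 1)) = M + M / (q - 1) := by
        have : q - 1 ≠ 0 := by linarith
        field_simp
        ring
      have h3 : q * y ≤ q * (M / (q - 1)) := mul_le_mul_of_nonneg_left ih.2 (by linarith)
      constructor <;> linarith

theorem value_greedyDigit (hq : 1 < q) (hqM : q ≤ M + 1) {x : ℝ}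
    (hx : x ∈ Set.Icc 0 (M / (q - 1))) (n : ℕ) :
    value q (fun k => greedyDigit M q (greedyOrbit M q x (n + k))) = greedyOrbit M q x n := by
  refine value_eq_of_recurrence (x := fun k => greedyOrbit M q x (n + k)) (B := M / (q - 1)) hq
    (fun k => greedyOrbit_succ M q x (n + k)) fun k => ?_
  have := greedyOrbit_mem hq hqM hx (n + k)
  rw [abs_of_nonneg this.1]
  exact this.2

theorem exists_expansion (hq : 1 < q) (hqM : q ≤ M + 1) {x : ℝ}
    (hx : x ∈ Set.Icc 0 (M / (q - 1))) : ∃ c : ℕ → Fin (M + 1), IsExpansion q x c := by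
  refine ⟨fun k => greedyDigit M q (greedyOrbit M q x k), ?_⟩
  have := value_greedyDigit hq hqM hx 0
  simpa [IsExpansion, greedyOrbit] using this

theorem one_mem (hq : 1 < q) (hqM : q ≤ M + 1) : (1 : ℝ) ∈ Set.Icc (0 : ℝ) (M / (q - 1)) :=
  ⟨zero_le_one, one_le_bound hq hqM⟩

/-- Two expansions of the same number have the same remainders up to their first difference. -/
theorem value_shift_eq (hq : 1 < q) {c d : ℕ → Fin (M + 1)} (h : value q c = value q d) {n : ℕ}
    (hn : ∀ k < n, c k = d k) :
    value q (fun k => c (n + k)) = value q (fun k => d (n + k)) := by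
  have hq0 : 0 < q := by linarith
  rw [value_eq_sum_add hq c n, value_eq_sum_add hq d n] at h
  rw [Finset.sum_congr rfl fun k hk => by rw [hn k (Finset.mem_range.mp hk)]] at h
  have := add_left_cancel h
  rwa [div_left_inj' (by positivity)] at this

theorem greedyDigit_coe (hqM : q < M + 1) {y : ℝ} (h0 : 0 ≤ y) (hy : y ≤ 1) (hq : 1 < q) :
    (greedyDigit M q y : ℕ) = ⌊q * y⌋₊ := by
  simp only [greedyDigit]
  apply min_eq_right
  have : q * y < M + 1 := by nlinarith
  exact Nat.lt_succ_iff.mp ((Nat.floor_lt (by positivity)).mpr (by push_cast; exact this))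

/-! ### The orbit of `1` -/

theorem orbit_mem_Icc (hq : 1 < q) (hqM : q < M + 1) (k : ℕ) :
    greedyOrbit M q 1 k ∈ Set.Icc (0 : ℝ) 1 ∧ greedyOrbit M q 1 (k + 1) ∈ Set.Ico (0 : ℝ) 1 := by
  have key : ∀ k, greedyOrbit M q 1 k ∈ Set.Icc (0 : ℝ) 1 →
      greedyOrbit M q 1 (k + 1) ∈ Set.Ico (0 : ℝ) 1 := by
    intro k hk
    rw [greedyOrbit_succ, greedyDigit_coe hqM hk.1 hk.2 hq]
    have h0 : 0 ≤ q * greedyOrbit M q 1 k := mul_nonneg (by linarith) hk.1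
    have h1 := Nat.floor_le h0
    have h2 := Nat.lt_floor_add_one (q * greedyOrbit M q 1 k)
    constructor <;> linarith
  induction k with
  | zero =>
    have h : greedyOrbit M q 1 0 ∈ Set.Icc (0 : ℝ) 1 := by simp [greedyOrbit]
    exact ⟨h, key 0 h⟩
  | succ k ih =>
    have h := Set.Ico_subset_Icc_self ih.2
    exact ⟨h, key _ h⟩

theorem orbit_nonneg (hq : 1 < q) (hqM : q < M + 1) (k : ℕ) : 0 ≤ greedyOrbit M q 1 k :=
  (orbit_mem_Icc hq hqM k).1.1

theorem orbit_le_one (hq : 1 < q) (hqM : q < M + 1) (k : ℕ) : greedyOrbit M q 1 k ≤ 1 :=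
  (orbit_mem_Icc hq hqM k).1.2

theorem orbit_lt_one (hq : 1 < q) (hqM : q < M + 1) {k : ℕ} (hk : 1 ≤ k) :
    greedyOrbit M q 1 k < 1 := by
  obtain ⟨k, rfl⟩ := Nat.exists_eq_add_of_le' hk
  exact (orbit_mem_Icc hq hqM k).2.2

/-- The greedy digits of `1` in base `q`. -/
noncomputable def orbitDigit (M : ℕ) (q : ℝ) (k : ℕ) : Fin (M + 1) :=
  greedyDigit M q (greedyOrbit M q 1 k)

theorem orbit_succ (M : ℕ) (q : ℝ) (k : ℕ) :
    greedyOrbit M q 1 (k + 1) = q * greedyOrbit M q 1 k - (orbitDigit M q k : ℕ) := rfl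

theorem orbitDigit_eq_of (hq : 1 < q) (hqM : q < M + 1) {k n : ℕ}
    (h0 : (n : ℝ) ≤ q * greedyOrbit M q 1 k) (h1 : q * greedyOrbit M q 1 k < n + 1) :
    (orbitDigit M q k : ℕ) = n := by
  rw [orbitDigit, greedyDigit_coe hqM (orbit_nonneg hq hqM k) (orbit_le_one hq hqM k) hq]
  exact (Nat.floor_eq_iff (mul_nonneg (by linarith) (orbit_nonneg hq hqM k))).mpr ⟨h0, h1⟩

theorem value_orbitDigit (hq : 1 < q) (hqM : q < M + 1) (n : ℕ) :
    value q (fun k => orbitDigit M q (n + k)) = greedyOrbit M q 1 n :=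
  value_greedyDigit hq hqM.le (one_mem hq hqM.le) n

theorem isExpansion_orbitDigit (hq : 1 < q) (hqM : q < M + 1) :
    IsExpansion q 1 (orbitDigit M q) := by
  have := value_orbitDigit hq hqM 0
  simpa [IsExpansion, greedyOrbit] using this

theorem one_le_orbitDigit_zero (hq : 1 < q) (hqM : q < M + 1) : 1 ≤ (orbitDigit M q 0 : ℕ) := by
  rw [orbitDigit, greedyDigit_coe hqM (orbit_nonneg hq hqM 0) (orbit_le_one hq hqM 0) hq]
  exact Nat.le_floor (by simpa [greedyOrbit] using hq.le)

/-- At the first index where an expansion of `1` differs from the greedy one, its digit is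
smaller and its remainder exceeds the greedy remainder by at least `1`. -/
theorem first_difference (hq : 1 < q) (hqM : q < M + 1) {w : ℕ → Fin (M + 1)}
    (hw : IsExpansion q 1 w) {n : ℕ} (hn : ∀ k < n, orbitDigit M q k = w k)
    (hne : orbitDigit M q n ≠ w n) :
    w n < orbitDigit M q n ∧ greedyOrbit M q 1 (n + 1) + 1 ≤ M / (q - 1) := by
  have h1 : value q (orbitDigit M q) = value q w :=
    (isExpansion_orbitDigit hq hqM).trans hw.symm
  have h2 := value_shift_eq hq h1 hn
  rw [value_orbitDigit hq hqM] at h2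
  have h3 := value_shift hq w n
  rw [← h2] at h3
  have h4 := orbit_succ M q n
  have hr0 := value_nonneg hq (fun k => w (n + 1 + k))
  have hr1 := value_le hq (fun k => w (n + 1 + k))
  have hx := orbit_lt_one hq hqM (k := n + 1) (by omega)
  have hne' : (orbitDigit M q n : ℕ) ≠ w n := fun h => hne (Fin.ext h)
  rcases Nat.lt_or_gt_of_ne hne' with h | h
  · have : ((orbitDigit M q n : ℕ) : ℝ) + 1 ≤ (w n : ℕ) := by exact_mod_cast h
    linarith
  · have h' : ((w n : ℕ) : ℝ) + 1 ≤ (orbitDigit M q n : ℕ) := by exact_mod_cast h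
    exact ⟨h, by linarith⟩

theorem isGreedyExpansion_orbitDigit (hq : 1 < q) (hqM : q < M + 1) :
    IsGreedyExpansion q 1 (orbitDigit M q) := by
  refine ⟨isExpansion_orbitDigit hq hqM, fun w hw => ?_⟩
  by_contra hlt
  rw [not_le] at hlt
  obtain ⟨n, hn, hlt⟩ := hlt
  exact lt_asymm hlt (first_difference hq hqM hw hn hlt.ne).1

/-! ### Univoque bases and the orbit of `1` -/

theorem mem_univoqueBases_of_lt (hq : 1 < q) (hqM : q < M + 1)
    (h : ∀ k, 1 ≤ k → M / (q - 1) - 1 < greedyOrbit M q 1 k) : q ∈ univoqueBases M := by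
  refine ⟨hq, hqM.le, orbitDigit M q, isExpansion_orbitDigit hq hqM, fun w hw => ?_⟩
  by_contra hne
  have hex : ∃ n, orbitDigit M q n ≠ w n := by
    by_contra hall
    push Not at hall
    exact hne (funext fun n => (hall n).symm)
  classical
  have h1 := (first_difference hq hqM hw (n := Nat.find hex)
    (fun k hk => by simpa using Nat.find_min hex hk) (Nat.find_spec hex)).2
  have h2 := h (Nat.find hex + 1) (by omega)
  linarith

/-- If `x_k` were the first remainder not above `M / (q - 1) - 1`, then the digit before it would be
positive, and lowering this digit by one and expanding `x_k + 1` would give a second expansion of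
`1`. -/
theorem lt_orbit_of_mem_univoqueBases (hU : q ∈ univoqueBases M) (hqM : q < M + 1) {k : ℕ}
    (hk : 1 ≤ k) : M / (q - 1) - 1 < greedyOrbit M q 1 k := by
  have hq := hU.1
  have hq0 : 0 < q := by linarith
  by_contra hcon
  have hex : ∃ k, 1 ≤ k ∧ greedyOrbit M q 1 k ≤ M / (q - 1) - 1 := ⟨k, hk, not_lt.mp hcon⟩
  classical
  obtain ⟨hn1, hn⟩ := Nat.find_spec hex
  have hmin := fun m (hm : m < Nat.find hex) => Nat.find_min hex hm
  obtain ⟨n, hn'⟩ := Nat.exists_eq_add_of_le' hn1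
  rw [hn'] at hn hmin
  have hs := orbit_succ M q n
  have hx0 := orbit_nonneg hq hqM n
  have hd : 1 ≤ (orbitDigit M q n : ℕ) := by
    by_contra hd
    have hd0 : (orbitDigit M q n : ℕ) = 0 := by omega
    have hn0 : n ≠ 0 := by
      rintro rfl
      have := one_le_orbitDigit_zero hq hqM
      omega
    apply hmin n (by omega)
    refine ⟨by omega, ?_⟩
    rw [hd0] at hs
    push_cast at hs
    nlinarith
  obtain ⟨e, he⟩ := exists_expansion (M := M) hq hqM.le (x := greedyOrbit M q 1 (n + 1) + 1)
    ⟨by linarith [orbit_nonneg hq hqM (n + 1)], by linarith⟩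
  let f : ℕ → Fin (M + 1) := fun k => if k < n then orbitDigit M q k else
    if k = n then ⟨(orbitDigit M q n : ℕ) - 1, by omega⟩ else e (k - (n + 1))
  have hfn : ((f n : ℕ) : ℝ) = (orbitDigit M q n : ℕ) - 1 := by
    simp only [f, lt_irrefl, if_false, if_true]
    push_cast [hd]
    ring
  have hf1 : value q (fun k => f (n + 1 + k)) = greedyOrbit M q 1 (n + 1) + 1 := by
    rw [← he]
    congr 1
    funext k
    simp only [f]
    rw [if_neg (by omega), if_neg (by omega)]
    congr 1
    omega
  have hf2 : value q (fun k => f (n + k)) = greedyOrbit M q 1 n := by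
    have := value_shift hq f n
    rw [hf1, hfn, hs] at this
    have h : q * (value q (fun k => f (n + k)) - greedyOrbit M q 1 n) = 0 := by linarith
    rcases mul_eq_zero.mp h with h | h <;> linarith
  have hf3 : IsExpansion q 1 f := by
    have h := isExpansion_orbitDigit hq hqM
    unfold IsExpansion at h ⊢
    rw [value_eq_sum_add hq _ n, value_orbitDigit hq hqM] at h
    rw [value_eq_sum_add hq _ n, hf2]
    refine Eq.trans ?_ h
    congr 1
    refine Finset.sum_congr rfl fun k hk => ?_
    simp only [f, if_pos (Finset.mem_range.mp hk)]
  have hfeq := hU.2.2.unique hf3 (isExpansion_orbitDigit hq hqM)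
  rw [hfeq] at hfn
  linarith

/-- If the orbit of `1` first meets `M / (q - 1) - 1` at time `j`, then it runs through the
reflections of its first `j` points and reaches `0` at time `2 j`. -/
theorem orbit_reflection (hq : 1 < q) (hqM : q < M + 1) {j : ℕ} (hj : 1 ≤ j)
    (hlt : ∀ i, 1 ≤ i → i < j → M / (q - 1) - 1 < greedyOrbit M q 1 i)
    (heq : greedyOrbit M q 1 j = M / (q - 1) - 1) :
    (∀ i, i < j → greedyOrbit M q 1 (j + i) = M / (q - 1) - greedyOrbit M q 1 i) ∧
      (∀ i, i + 1 < j → (orbitDigit M q (j + i) : ℕ) + orbitDigit M q i = M) ∧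
      (orbitDigit M q (j + (j - 1)) : ℕ) + orbitDigit M q (j - 1) = M + 1 ∧
      greedyOrbit M q 1 (2 * j) = 0 := by
  have hLq : q * (M / (q - 1)) = M + M / (q - 1) := by
    have : q - 1 ≠ 0 := by linarith
    field_simp
    ring
  have hL := one_le_bound hq hqM.le
  have hdM : ∀ i, (orbitDigit M q i : ℕ) ≤ M := fun i => Nat.lt_succ_iff.mp (orbitDigit M q i).isLt
  have key : ∀ i, i < j → greedyOrbit M q 1 (j + i) = M / (q - 1) - greedyOrbit M q 1 i := by
    intro i
    induction i with
    | zero => intro _; rw [add_zero, heq]; simp [greedyOrbit]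
    | succ i ih =>
      intro hi
      have ih := ih (by omega)
      have hs := orbit_succ M q i
      have hc : ((M - (orbitDigit M q i : ℕ) : ℕ) : ℝ) = M - (orbitDigit M q i : ℕ) :=
        Nat.cast_sub (hdM i)
      have h1 := hlt (i + 1) (by omega) hi
      have h2 := orbit_lt_one hq hqM (k := i + 1) (by omega)
      have hdig : (orbitDigit M q (j + i) : ℕ) = M - (orbitDigit M q i : ℕ) := by
        apply orbitDigit_eq_of hq hqM <;> rw [ih, hc, mul_sub, hLq] <;> linarith
      rw [← add_assoc, orbit_succ, ih, hdig, hc, mul_sub, hLq, hs]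
      ring
  have hlast : (orbitDigit M q (j + (j - 1)) : ℕ) = M - (orbitDigit M q (j - 1) : ℕ) + 1 := by
    have hs := orbit_succ M q (j - 1)
    rw [Nat.sub_add_cancel hj, heq] at hs
    have hc : ((M - (orbitDigit M q (j - 1) : ℕ) + 1 : ℕ) : ℝ)
        = M - (orbitDigit M q (j - 1) : ℕ) + 1 := by
      rw [Nat.cast_add_one, Nat.cast_sub (hdM _)]
    apply orbitDigit_eq_of hq hqM <;> rw [key (j - 1) (by omega), hc, mul_sub, hLq] <;> linarith
  refine ⟨key, fun i hi => ?_, ?_, ?_⟩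
  · have hs := orbit_succ M q (j + i)
    have hs' := orbit_succ M q i
    rw [add_assoc, key (i + 1) hi, key i (by omega), mul_sub, hLq] at hs
    have : ((orbitDigit M q (j + i) : ℕ) : ℝ) + (orbitDigit M q i : ℕ) = M := by linarith
    exact_mod_cast this
  · have := hdM (j - 1)
    omega
  · have hs := orbit_succ M q (j + (j - 1))
    have hs' := orbit_succ M q (j - 1)
    rw [Nat.sub_add_cancel hj, heq] at hs'
    have hc : ((M - (orbitDigit M q (j - 1) : ℕ) + 1 : ℕ) : ℝ)
        = M - (orbitDigit M q (j - 1) : ℕ) + 1 := by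
      rw [Nat.cast_add_one, Nat.cast_sub (hdM _)]
    rw [key (j - 1) (by omega), hlast, hc, mul_sub, hLq] at hs
    rw [show 2 * j = j + (j - 1) + 1 by omega, hs]
    linarith

/-- If the orbit of `1` never fell below `M / (q - 1) - 1`, it would have to meet this value, and
by the reflection it would then reach `0`. -/
theorem exists_orbit_lt (hq : 1 < q) (hqM : q < M + 1) (hU : q ∉ univoqueBases M) :
    ∃ k, 1 ≤ k ∧ greedyOrbit M q 1 k < M / (q - 1) - 1 := by
  by_contra hcon
  push Not at hcon
  have hpos : 0 < M / (q - 1) - 1 := by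
    rw [sub_pos, lt_div_iff₀ (by linarith)]; linarith
  have hex : ∃ k, 1 ≤ k ∧ greedyOrbit M q 1 k = M / (q - 1) - 1 := by
    by_contra hne
    push Not at hne
    exact hU (mem_univoqueBases_of_lt hq hqM fun k hk =>
      lt_of_le_of_ne (hcon k hk) (hne k hk).symm)
  classical
  obtain ⟨h1, h2⟩ := Nat.find_spec hex
  have h3 := (orbit_reflection hq hqM h1 (fun i hi hij => lt_of_le_of_ne (hcon i hi)
    fun h => Nat.find_min hex hij ⟨hi, h.symm⟩) h2).2.2.2
  have := hcon (2 * Nat.find hex) (by omega)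
  linarith

/-! ### The closure of the set of univoque bases -/

theorem add_one_mem_univoqueBases (hM : 1 ≤ M) : (M + 1 : ℝ) ∈ univoqueBases M := by
  have hM' : (1 : ℝ) ≤ M := by exact_mod_cast hM
  have hq : (1 : ℝ) < M + 1 := by linarith
  have hL : (M : ℝ) / (M + 1 - 1) = 1 := by
    rw [add_sub_cancel_right]
    exact div_self (by linarith)
  refine ⟨hq, le_rfl, ?_⟩
  obtain ⟨c, hc⟩ := exists_expansion (M := M) hq le_rfl (one_mem hq le_rfl)
  have key : ∀ w : ℕ → Fin (M + 1), IsExpansion (M + 1 : ℝ) 1 w → ∀ k, (w k : ℕ) = M := by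
    intro w hw
    have step : ∀ k, value (M + 1 : ℝ) (fun i => w (k + i)) = 1 →
        (w k : ℕ) = M ∧ value (M + 1 : ℝ) (fun i => w (k + 1 + i)) = 1 := by
      intro k hk
      have h1 := value_shift hq w k
      have h2 := value_le hq (fun i => w (k + 1 + i))
      have h3 : (w k : ℕ) ≤ M := Nat.lt_succ_iff.mp (w k).isLt
      rw [hk] at h1
      rw [hL] at h2
      have h4 : M ≤ (w k : ℕ) := by
        have : (M : ℝ) ≤ (w k : ℕ) := by linarith
        exact_mod_cast this
      have h5 : (w k : ℕ) = M := le_antisymm h3 h4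
      refine ⟨h5, ?_⟩
      rw [h1, h5]
      ring
    have all : ∀ k, value (M + 1 : ℝ) (fun i => w (k + i)) = 1 := by
      intro k
      induction k with
      | zero => simpa [IsExpansion] using hw
      | succ k ih => exact (step k ih).2
    exact fun k => (step k (all k)).1
  exact ⟨c, hc, fun w hw => funext fun k => Fin.ext ((key w hw k).trans (key c hc k).symm)⟩

theorem lt_of_mem_univoqueBases (hM : 1 ≤ M) (hU : q ∈ univoqueBases M) :
    (M : ℝ) / 2 + 1 < q := by
  have hM' : (1 : ℝ) ≤ M := by exact_mod_cast hM
  rcases hU.2.1.eq_or_lt with h | h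
  · rw [h]; linarith
  · have h1 := lt_orbit_of_mem_univoqueBases hU h le_rfl
    have h2 := orbit_lt_one hU.1 h le_rfl
    have h3 : M / (q - 1) < 2 := by linarith
    rw [div_lt_iff₀ (by linarith [hU.1])] at h3
    linarith

theorem bounds_of_mem_closure_diff (hM : 1 ≤ M)
    (hq : q ∈ closure (univoqueBases M) \ univoqueBases M) :
    1 < q ∧ q < M + 1 := by
  have hM' : (1 : ℝ) ≤ M := by exact_mod_cast hM
  have h1 : closure (univoqueBases M) ⊆ Set.Icc ((M : ℝ) / 2 + 1) (M + 1) :=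
    closure_minimal (fun p hp => ⟨(lt_of_mem_univoqueBases hM hp).le, hp.2.1⟩) isClosed_Icc
  have h2 := h1 hq.1
  refine ⟨by linarith [h2.1], lt_of_le_of_ne h2.2 ?_⟩
  rintro rfl
  exact hq.2 (add_one_mem_univoqueBases hM)

/-- As long as the orbit of `1` in base `q` avoids `0`, it depends continuously on the base, and
its digits are locally constant. -/
theorem orbit_continuousAt (hq : 1 < q) (hqM : q < M + 1) {n : ℕ}
    (hne : ∀ i, 1 ≤ i → i ≤ n → greedyOrbit M q 1 i ≠ 0) :
    (∀ k ≤ n, ContinuousAt (fun p => greedyOrbit M p 1 k) q) ∧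
      ∀ k < n, ∀ᶠ p in 𝓝 q, orbitDigit M p k = orbitDigit M q k := by
  have hdig : ∀ k, k < n → ContinuousAt (fun p => greedyOrbit M p 1 k) q →
      ∀ᶠ p in 𝓝 q, orbitDigit M p k = orbitDigit M q k := by
    intro k hk hc
    have hs := orbit_succ M q k
    have hpos : 0 < greedyOrbit M q 1 (k + 1) :=
      lt_of_le_of_ne (orbit_nonneg hq hqM _) (hne (k + 1) (by omega) (by omega)).symm
    have hlt := orbit_lt_one hq hqM (k := k + 1) (by omega)
    have hc' : ContinuousAt (fun p => p * greedyOrbit M p 1 k) q := continuousAt_id.mul hc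
    filter_upwards [lt_mem_nhds hq, gt_mem_nhds hqM,
      hc'.eventually_const_lt (u := ((orbitDigit M q k : ℕ) : ℝ)) (by linarith),
      hc'.eventually_lt_const (u := ((orbitDigit M q k : ℕ) : ℝ) + 1) (by linarith)]
      with p h1 h2 h3 h4
    exact Fin.ext (orbitDigit_eq_of h1 h2 h3.le h4)
  have hcont : ∀ k ≤ n, ContinuousAt (fun p => greedyOrbit M p 1 k) q := by
    intro k
    induction k with
    | zero => intro _; exact continuousAt_const
    | succ k ih =>
      intro hk
      have ih := ih (by omega)
      have hc' : ContinuousAt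
          (fun p => p * greedyOrbit M p 1 k - ((orbitDigit M q k : ℕ) : ℝ)) q :=
        (continuousAt_id.mul ih).sub continuousAt_const
      refine hc'.congr ?_
      filter_upwards [hdig k (by omega) ih] with p hp
      rw [orbit_succ, hp]
  exact ⟨hcont, fun k hk => hdig k hk (hcont k hk.le)⟩

theorem continuousAt_bound (hq : 1 < q) : ContinuousAt (fun p : ℝ => (M : ℝ) / (p - 1) - 1) q := by
  have : q - 1 ≠ 0 := by linarith
  fun_prop (disch := assumption)

theorem exists_mem_of_eventually (hqM : q < M + 1) (hcl : q ∈ closure (univoqueBases M))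
    {P : ℝ → Prop} (hP : ∀ᶠ p in 𝓝 q, P p) : ∃ p ∈ univoqueBases M, p < M + 1 ∧ P p := by
  have := mem_closure_iff_frequently.mp hcl
  obtain ⟨p, hp, h⟩ := (this.and_eventually (hP.and (gt_mem_nhds hqM))).exists
  exact ⟨p, hp, h.2, h.1⟩

/-- In a base `q ∈ closure 𝒰 \ 𝒰` the orbit of `1` reaches `0`, and not before that it takes
values below `M / (q - 1) - 1`. -/
theorem exists_orbit_eq_zero (hM : 1 ≤ M)
    (hq : q ∈ closure (univoqueBases M) \ univoqueBases M) :
    ∃ N, 1 ≤ N ∧ greedyOrbit M q 1 N = 0 ∧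
      ∀ k, 1 ≤ k → k < N → M / (q - 1) - 1 ≤ greedyOrbit M q 1 k := by
  obtain ⟨hq1, hqM⟩ := bounds_of_mem_closure_diff hM hq
  have hex := exists_orbit_lt hq1 hqM hq.2
  have hpos : 0 < M / (q - 1) - 1 := by
    rw [sub_pos, lt_div_iff₀ (by linarith)]; linarith
  classical
  obtain ⟨hN1, hN⟩ := Nat.find_spec hex
  have hmin : ∀ k, 1 ≤ k → k < Nat.find hex → M / (q - 1) - 1 ≤ greedyOrbit M q 1 k := by
    intro k hk hkN
    by_contra h
    exact Nat.find_min hex hkN ⟨hk, not_le.mp h⟩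
  refine ⟨Nat.find hex, hN1, ?_, hmin⟩
  by_contra hne
  have hne' : ∀ i, 1 ≤ i → i ≤ Nat.find hex → greedyOrbit M q 1 i ≠ 0 := by
    intro i hi hiN
    rcases hiN.eq_or_lt with h | h
    · rwa [h]
    · linarith [hmin i hi h]
  have hc := (orbit_continuousAt hq1 hqM hne').1 _ le_rfl
  obtain ⟨p, hpU, hpM, hp⟩ := exists_mem_of_eventually hqM hq.1
    (hc.eventually_lt (continuousAt_bound hq1) hN)
  exact lt_asymm hp (lt_orbit_of_mem_univoqueBases hpU hpM hN1)

/-- If the orbit of `1` in base `q` first reaches `0` at time `N`, then the univoque bases close to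
`q` share its greedy digits up to the `N`-th one, which they lower by one. -/
theorem exists_univoque_base_near (hq : 1 < q) (hqM : q < M + 1)
    (hcl : q ∈ closure (univoqueBases M)) {N : ℕ} (hN : greedyOrbit M q 1 (N + 1) = 0)
    (hne : ∀ i, 1 ≤ i → i ≤ N → greedyOrbit M q 1 i ≠ 0) :
    ∃ p ∈ univoqueBases M, p < M + 1 ∧ p * greedyOrbit M p 1 N < q * greedyOrbit M q 1 N ∧
      (∀ k < N, orbitDigit M p k = orbitDigit M q k) ∧
      (orbitDigit M p N : ℕ) + 1 = orbitDigit M q N := by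
  obtain ⟨hc, hd⟩ := orbit_continuousAt hq hqM hne
  have hpos : 0 < M / (q - 1) - 1 := by
    rw [sub_pos, lt_div_iff₀ (by linarith)]; linarith
  have hs := orbit_succ M q N
  rw [hN] at hs
  have hxN : 0 < greedyOrbit M q 1 N := by
    rcases Nat.eq_zero_or_pos N with rfl | h
    · simp [greedyOrbit]
    · exact lt_of_le_of_ne (orbit_nonneg hq hqM N) (hne N h le_rfl).symm
  have hd1 : 1 ≤ (orbitDigit M q N : ℕ) := by
    have : (0 : ℝ) < (orbitDigit M q N : ℕ) := by
      have : 0 < q * greedyOrbit M q 1 N := mul_pos (by linarith) hxN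
      linarith
    exact_mod_cast this
  have hc' : ContinuousAt (fun p => p * greedyOrbit M p 1 N) q := continuousAt_id.mul (hc N le_rfl)
  have hd' : ∀ᶠ p in 𝓝 q, ∀ k < N, orbitDigit M p k = orbitDigit M q k := by
    have := (Filter.eventually_all_finset (Finset.range N)).mpr
      fun k hk => hd k (Finset.mem_range.mp hk)
    filter_upwards [this] with p hp k hk using hp k (Finset.mem_range.mpr hk)
  have hsmall : ∀ᶠ p in 𝓝 q, p * greedyOrbit M p 1 N - (orbitDigit M q N : ℕ) <
      M / (p - 1) - 1 :=
    (hc'.sub continuousAt_const).eventually_lt (continuousAt_bound hq)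
      (by simp only [Pi.sub_apply]; linarith)
  obtain ⟨p, hpU, hpM, h1, h2, h3, h4⟩ := exists_mem_of_eventually hqM hcl
    (hd'.and (hsmall.and ((hc'.eventually_const_lt
      (u := ((orbitDigit M q N : ℕ) : ℝ) - 1) (by linarith)).and
      (hc'.eventually_lt_const (u := ((orbitDigit M q N : ℕ) : ℝ) + 1) (by linarith)))))
  have hlt : p * greedyOrbit M p 1 N < (orbitDigit M q N : ℕ) := by
    by_contra hge
    have hdig := orbitDigit_eq_of hpU.1 hpM (not_lt.mp hge) h4
    have hsp := orbit_succ M p N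
    rw [hdig] at hsp
    have := lt_orbit_of_mem_univoqueBases hpU hpM (k := N + 1) (by omega)
    linarith
  refine ⟨p, hpU, hpM, by linarith, h1, ?_⟩
  have hc1 : (((orbitDigit M q N : ℕ) - 1 : ℕ) : ℝ) = (orbitDigit M q N : ℕ) - 1 := by
    push_cast [hd1]; ring
  have := orbitDigit_eq_of (n := (orbitDigit M q N : ℕ) - 1) hpU.1 hpM
    (by rw [hc1]; exact h3.le) (by rw [hc1]; linarith)
  omega

theorem bound_lt_one (hM : 1 ≤ M) (hq : q ∈ closure (univoqueBases M) \ univoqueBases M) :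
    M / (q - 1) - 1 < 1 := by
  obtain ⟨hq1, hqM⟩ := bounds_of_mem_closure_diff hM hq
  obtain ⟨N, hN1, hN, hmin⟩ := exists_orbit_eq_zero hM hq
  rcases hN1.eq_or_lt with rfl | hN2
  · obtain ⟨p, hpU, hpM, h1, -⟩ := exists_univoque_base_near hq1 hqM hq.1 (N := 0) hN
      (by intros; omega)
    simp only [greedyOrbit, mul_one] at h1
    have h2 := lt_of_mem_univoqueBases hM hpU
    have : M / (q - 1) < 2 := by
      rw [div_lt_iff₀ (by linarith)]
      linarith
    linarith
  · linarith [hmin 1 le_rfl hN2, orbit_lt_one hq1 hqM le_rfl]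

/-- In a base `q ∈ closure 𝒰 \ 𝒰` the orbit of `1` stays above `M / (q - 1) - 1` until it
reaches `0`. -/
theorem exists_orbit_eq_zero_and_lt (hM : 1 ≤ M)
    (hq : q ∈ closure (univoqueBases M) \ univoqueBases M) :
    ∃ N, 1 ≤ N ∧ greedyOrbit M q 1 N = 0 ∧
      ∀ k, k < N → M / (q - 1) - 1 < greedyOrbit M q 1 k := by
  obtain ⟨hq1, hqM⟩ := bounds_of_mem_closure_diff hM hq
  obtain ⟨N, hN1, hN, hmin⟩ := exists_orbit_eq_zero hM hq
  have hpos : 0 < M / (q - 1) - 1 := by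
    rw [sub_pos, lt_div_iff₀ (by linarith)]; linarith
  refine ⟨N, hN1, hN, ?_⟩
  by_contra hcon
  push Not at hcon
  classical
  have hex : ∃ k, 1 ≤ k ∧ k < N ∧ greedyOrbit M q 1 k = M / (q - 1) - 1 := by
    obtain ⟨k, hk, hle⟩ := hcon
    have hk1 : 1 ≤ k := by
      rcases Nat.eq_zero_or_pos k with rfl | h
      · have := bound_lt_one hM hq
        simp only [greedyOrbit] at hle
        linarith
      · exact h
    exact ⟨k, hk1, hk, le_antisymm hle (hmin k hk1 hk)⟩
  obtain ⟨hj1, hjN, hj⟩ := Nat.find_spec hex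
  have hfmin : ∀ i, 1 ≤ i → i < Nat.find hex → M / (q - 1) - 1 < greedyOrbit M q 1 i :=
    fun i hi hij => lt_of_le_of_ne (hmin i hi (by omega))
      fun h => Nat.find_min hex hij ⟨hi, by omega, h.symm⟩
  set j := Nat.find hex
  obtain ⟨hr1, hr2, hr3, hr4⟩ := orbit_reflection hq1 hqM hj1 hfmin hj
  have hN2j : N = 2 * j := by
    rcases lt_trichotomy N (2 * j) with h | h | h
    · exfalso
      have := hr1 (N - j) (by omega)
      rw [show j + (N - j) = N by omega, hN] at this
      linarith [orbit_le_one hq1 hqM (N - j)]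
    · exact h
    · linarith [hmin (2 * j) (by omega) h]
  obtain ⟨p, hpU, hpM, -, hd, hl⟩ := exists_univoque_base_near hq1 hqM hq.1 (N := N - 1)
    (by rwa [Nat.sub_add_cancel hN1])
    (fun i hi hiN => by linarith [hmin i hi (by omega)])
  have hsum : ∀ i, i < j → (orbitDigit M p (j + i) : ℕ) + orbitDigit M p i = M := by
    intro i hi
    rcases Nat.lt_or_ge (i + 1) j with h | h
    · rw [hd _ (by omega), hd _ (by omega)]
      exact hr2 i h
    · obtain rfl : i = j - 1 := by omega
      rw [show N - 1 = j + (j - 1) by omega] at hl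
      rw [hd (j - 1) (by omega)]
      omega
  -- The distance of `x_{j+i} + x_i` to the fixed point `M / (p - 1)` of `x ↦ p x - M` is
  -- multiplied by `p` in each step.
  have hgrow : ∀ i, i ≤ j → greedyOrbit M p 1 (j + i) + greedyOrbit M p 1 i - M / (p - 1) =
      p ^ i * (greedyOrbit M p 1 j - (M / (p - 1) - 1)) := by
    intro i
    induction i with
    | zero => intro _; simp [greedyOrbit]; ring
    | succ i ih =>
      intro hi
      have h1 := ih (by omega)
      have h2 : ((orbitDigit M p (j + i) : ℕ) : ℝ) + (orbitDigit M p i : ℕ) = M := by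
        exact_mod_cast hsum i (by omega)
      have h3 : p * (M / (p - 1)) = M + M / (p - 1) := by
        have : p - 1 ≠ 0 := by linarith [hpU.1]
        field_simp
        ring
      rw [← add_assoc, orbit_succ, orbit_succ, pow_succ', mul_assoc, ← h1]
      linear_combination h3 - h2
  have h1 := hgrow j le_rfl
  have h2 := lt_orbit_of_mem_univoqueBases hpU hpM hj1
  have h3 := orbit_lt_one hpU.1 hpM (k := j + j) (by omega)
  have h4 : 1 ≤ p ^ j := one_le_pow₀ hpU.1.le
  nlinarith

variable {b : ℕ → Fin (M + 1)} {N : ℕ}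

/-! ### Gaps of the vertex region -/

theorem mem_vertexRegion {x : ℝ} : x ∈ vertexRegion q b N ↔
    (0 < x ∧ x < M / (q - 1)) ∧ (∀ j, 1 ≤ j → j ≤ M → x < theta q j ∨ eta M q j < x) ∧
      ∀ i, 1 ≤ i → i ≤ N → x ≠ aPt q b i ∧ x ≠ bPt q b i := by
  simp only [vertexRegion, switchRegion, Set.mem_sdiff, Set.mem_Ioo, Set.mem_union, Set.mem_iUnion,
    Set.mem_image, Set.mem_Icc, not_or, not_exists, not_and, exists_prop]
  constructor
  · rintro ⟨h0, ⟨h1, h2⟩, h3⟩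
    refine ⟨h0, fun j hj hj' => ?_, fun i hi hi' =>
      ⟨fun h => h2 i ⟨hi, hi'⟩ h.symm, fun h => h3 i ⟨hi, hi'⟩ h.symm⟩⟩
    by_contra hcon
    push Not at hcon
    exact h1 j ⟨hj, hj'⟩ hcon.1 hcon.2
  · rintro ⟨h0, h1, h2⟩
    refine ⟨h0, ⟨fun j hj h h' => ?_, fun i hi h => (h2 i hi.1 hi.2).1 h.symm⟩,
      fun i hi h => (h2 i hi.1 hi.2).2 h.symm⟩
    rcases h1 j hj.1 hj.2 with h'' | h'' <;> linarith

theorem isOpen_vertexRegion : IsOpen (vertexRegion q b N) := by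
  refine isOpen_Ioo.sdiff ((IsClosed.union ?_ ?_).union ?_)
  · exact (Set.finite_Icc 1 M).isClosed_biUnion fun j _ => isClosed_Icc
  · exact ((Set.finite_Icc 1 N).image _).isClosed
  · exact ((Set.finite_Icc 1 N).image _).isClosed

/-- The interval `(c, d)` is a connected component of the vertex region. -/
def IsGap (q : ℝ) (b : ℕ → Fin (M + 1)) (N : ℕ) (c d : ℝ) : Prop :=
  c < d ∧ c ∉ vertexRegion q b N ∧ d ∉ vertexRegion q b N ∧ Set.Ioo c d ⊆ vertexRegion q b N

theorem IsGap.le_of_lt {c d p : ℝ} (h : IsGap q b N c d) (hp : p ∉ vertexRegion q b N)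
    (hcp : c < p) : d ≤ p := by
  by_contra hlt
  exact hp (h.2.2.2 ⟨hcp, not_le.mp hlt⟩)

theorem IsGap.ge_of_lt {c d p : ℝ} (h : IsGap q b N c d) (hp : p ∉ vertexRegion q b N)
    (hpd : p < d) : p ≤ c := by
  by_contra hlt
  exact hp (h.2.2.2 ⟨not_le.mp hlt, hpd⟩)

theorem IsGap.eq_of_overlap {c d c' d' : ℝ} (h : IsGap q b N c d) (h' : IsGap q b N c' d')
    (h1 : c < d') (h2 : c' < d) : c = c' ∧ d = d' :=
  ⟨le_antisymm (h'.ge_of_lt h.2.1 h1) (h.ge_of_lt h'.2.1 h2),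
    le_antisymm (h.le_of_lt h'.2.2.1 h1) (h'.le_of_lt h.2.2.1 h2)⟩

theorem exists_gap_eq_component {x : ℝ} (hx : x ∈ vertexRegion q b N) :
    ∃ c d, IsGap q b N c d ∧ x ∈ Set.Ioo c d ∧
      connectedComponentIn (vertexRegion q b N) x = Set.Ioo c d := by
  set R := vertexRegion q b N
  set C := connectedComponentIn R x
  have hxC : x ∈ C := mem_connectedComponentIn hx
  have hCR : C ⊆ R := connectedComponentIn_subset R x
  have hCI : C ⊆ Set.Ioo 0 (M / (q - 1)) := hCR.trans Set.sdiff_subset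
  have hbb : BddBelow C := ⟨0, fun y hy => (hCI hy).1.le⟩
  have hba : BddAbove C := ⟨M / (q - 1), fun y hy => (hCI hy).2.le⟩
  have hCo : IsOpen C := isOpen_vertexRegion.connectedComponentIn
  have hCp : IsPreconnected C := isPreconnected_connectedComponentIn
  have hC : C = Set.Ioo (sInf C) (sSup C) := by
    refine Set.Subset.antisymm ?_ ?_
    · rw [← interior_Icc]
      exact interior_maximal (fun y hy => ⟨csInf_le hbb hy, le_csSup hba hy⟩) hCo
    · exact IsConnected.Ioo_csInf_csSup_subset ⟨⟨x, hxC⟩, hCp⟩ hbb hba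
  have hxI : x ∈ Set.Ioo (sInf C) (sSup C) := hC ▸ hxC
  have hIR : Set.Ioo (sInf C) (sSup C) ⊆ R := hC ▸ hCR
  refine ⟨sInf C, sSup C, ⟨hxI.1.trans hxI.2, fun h => ?_, fun h => ?_, hIR⟩, hxI, hC⟩
  · have hsub : Set.Ico (sInf C) (sSup C) ⊆ R := by
      rintro y ⟨hy1, hy2⟩
      rcases hy1.eq_or_lt with h' | h'
      · exact h' ▸ h
      · exact hIR ⟨h', hy2⟩
    have h1 : sInf C ∈ C := isPreconnected_Ico.subset_connectedComponentIn
      (Set.Ioo_subset_Ico_self hxI) hsub ⟨le_rfl, hxI.1.trans hxI.2⟩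
    rw [hC] at h1
    exact absurd h1.1 (by rw [← hC]; exact lt_irrefl _)
  · have hsub : Set.Ioc (sInf C) (sSup C) ⊆ R := by
      rintro y ⟨hy1, hy2⟩
      rcases hy2.eq_or_lt with h' | h'
      · exact h' ▸ h
      · exact hIR ⟨hy1, h'⟩
    have h1 : sSup C ∈ C := isPreconnected_Ioc.subset_connectedComponentIn
      (Set.Ioo_subset_Ioc_self hxI) hsub ⟨hxI.1.trans hxI.2, le_rfl⟩
    rw [hC] at h1
    exact absurd h1.2 (by rw [← hC]; exact lt_irrefl _)

theorem isVertex_iff {I : Set ℝ} :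
    (∃ x ∈ vertexRegion q b N, I = connectedComponentIn (vertexRegion q b N) x) ↔
      ∃ c d, IsGap q b N c d ∧ I = Set.Ioo c d := by
  constructor
  · rintro ⟨x, hx, rfl⟩
    obtain ⟨c, d, h, -, he⟩ := exists_gap_eq_component hx
    exact ⟨c, d, h, he⟩
  · rintro ⟨c, d, h, rfl⟩
    obtain ⟨x, hx⟩ := exists_between h.1
    obtain ⟨c', d', h', hx', he⟩ := exists_gap_eq_component (h.2.2.2 hx)
    obtain ⟨rfl, rfl⟩ := h.eq_of_overlap h' (hx.1.trans hx'.2) (hx'.1.trans hx.2)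
    exact ⟨x, h.2.2.2 hx, he.symm⟩

theorem Ioo_inj {c d c' d' : ℝ} (h : c < d) (he : Set.Ioo c d = Set.Ioo c' d') :
    c = c' ∧ d = d' := by
  have h' : c' < d' := by
    have : (Set.Ioo c' d').Nonempty := he ▸ Set.nonempty_Ioo.mpr h
    exact Set.nonempty_Ioo.mp this
  constructor
  · rw [← csInf_Ioo h, he, csInf_Ioo h']
  · rw [← csSup_Ioo h, he, csSup_Ioo h']

/-! ### The points `a_i`, `b_i` and the switch intervals -/

/-- The properties of the greedy expansion of `1` in a base of `closure 𝒰 \ 𝒰` that determine the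
structure of the graph: it ends with the digit of index `N`, and the points `a_i` lie in
`(b_1, 1)`, except for `a_1 = 1`. -/
structure IsFiniteGreedy (q : ℝ) (b : ℕ → Fin (M + 1)) (N : ℕ) : Prop where
  one_lt : 1 < q
  lt_add_one : q < M + 1
  one_le_N : 1 ≤ N
  aPt_one : aPt q b 1 = 1
  aPt_succ : ∀ i, 1 ≤ i → i < N → q * aPt q b i - (b (i - 1) : ℕ) = aPt q b (i + 1)
  aPt_last : q * aPt q b N = (b (N - 1) : ℕ)
  aPt_lt : ∀ i, 2 ≤ i → i ≤ N → aPt q b i < 1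
  lt_aPt : ∀ i, 1 ≤ i → i ≤ N → M / (q - 1) - 1 < aPt q b i

namespace IsFiniteGreedy

variable (H : IsFiniteGreedy q b N)
include H

theorem pos : 0 < q := by linarith [H.one_lt]

theorem one_lt_bound : 1 < M / (q - 1) := by
  rw [lt_div_iff₀ (by linarith [H.one_lt])]; linarith [H.lt_add_one]

theorem bound_lt_two : M / (q - 1) < 2 := by
  have := H.lt_aPt 1 le_rfl H.one_le_N
  rw [H.aPt_one] at this
  linarith

theorem mul_bound : q * (M / (q - 1)) = M + M / (q - 1) := by
  have : q - 1 ≠ 0 := by linarith [H.one_lt]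
  field_simp
  ring

theorem mul_theta (j : ℕ) : q * theta q j = j := by
  have := H.pos
  unfold theta
  field_simp

theorem mul_eta (j : ℕ) : q * eta M q j = j - 1 + M / (q - 1) := by
  have := H.pos
  have h : q - 1 ≠ 0 := by linarith [H.one_lt]
  have h' : q ^ 2 - q = q * (q - 1) := by ring
  unfold eta
  rw [h']
  field_simp

theorem lt_of_mul {x y : ℝ} (h : q * x < q * y) : x < y := lt_of_mul_lt_mul_left h H.pos.le

theorem le_of_mul {x y : ℝ} (h : q * x ≤ q * y) : x ≤ y := le_of_mul_le_mul_left h H.pos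

theorem eq_of_mul {x y : ℝ} (h : q * x = q * y) : x = y := mul_left_cancel₀ H.pos.ne' h

theorem bPt_one : bPt q b 1 = M / (q - 1) - 1 := by rw [bPt, H.aPt_one]

theorem aPt_le {i : ℕ} (h1 : 1 ≤ i) (hN : i ≤ N) : aPt q b i ≤ 1 := by
  rcases h1.eq_or_lt with rfl | h
  · exact H.aPt_one.le
  · exact (H.aPt_lt i h hN).le

theorem theta_lt_eta (j : ℕ) : theta q j < eta M q j :=
  H.lt_of_mul (by rw [H.mul_theta, H.mul_eta]; linarith [H.one_lt_bound])

theorem eta_lt_theta {i j : ℕ} (h : i < j) : eta M q i < theta q j := by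
  have h' : (i : ℝ) + 1 ≤ j := by exact_mod_cast h
  exact H.lt_of_mul (by rw [H.mul_theta, H.mul_eta]; linarith [H.bound_lt_two])

theorem bound_sub_theta {j : ℕ} (hj : j ≤ M) : M / (q - 1) - theta q j = eta M q (M + 1 - j) := by
  apply H.eq_of_mul
  rw [mul_sub, H.mul_theta, H.mul_eta, H.mul_bound, Nat.cast_sub (by omega)]
  push_cast
  ring

theorem bound_sub_eta {j : ℕ} (hj : j ≤ M) : M / (q - 1) - eta M q j = theta q (M + 1 - j) := by
  apply H.eq_of_mul
  rw [mul_sub, H.mul_theta, H.mul_eta, H.mul_bound, Nat.cast_sub (by omega)]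
  push_cast
  ring

theorem one_le_last : 1 ≤ (b (N - 1) : ℕ) := by
  have h1 : 0 < aPt q b N := by
    linarith [H.lt_aPt N H.one_le_N le_rfl, H.one_lt_bound]
  have h2 : (0 : ℝ) < (b (N - 1) : ℕ) := by
    rw [← H.aPt_last]; exact mul_pos H.pos h1
  exact_mod_cast h2

omit H in
theorem digit_le (i : ℕ) : (b i : ℕ) ≤ M := Nat.lt_succ_iff.mp (b i).isLt

theorem aPt_N : aPt q b N = theta q (b (N - 1) : ℕ) :=
  H.eq_of_mul (by rw [H.aPt_last, H.mul_theta])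

theorem bPt_N : bPt q b N = eta M q (M + 1 - (b (N - 1) : ℕ)) := by
  rw [bPt, H.aPt_N, H.bound_sub_theta (digit_le _)]

theorem bPt_succ (i : ℕ) (h1 : 1 ≤ i) (hN : i < N) :
    q * bPt q b i - (M - (b (i - 1) : ℕ) : ℕ) = bPt q b (i + 1) := by
  rw [bPt, bPt, ← H.aPt_succ i h1 hN, mul_sub, H.mul_bound, Nat.cast_sub (digit_le _)]
  ring

omit H in
theorem aPt_notMem {i : ℕ} (h1 : 1 ≤ i) (hN : i ≤ N) : aPt q b i ∉ vertexRegion q b N :=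
  fun h => ((mem_vertexRegion.mp h).2.2 i h1 hN).1 rfl

omit H in
theorem bPt_notMem {i : ℕ} (h1 : 1 ≤ i) (hN : i ≤ N) : bPt q b i ∉ vertexRegion q b N :=
  fun h => ((mem_vertexRegion.mp h).2.2 i h1 hN).2 rfl

theorem one_notMem : (1 : ℝ) ∉ vertexRegion q b N :=
  H.aPt_one ▸ aPt_notMem le_rfl H.one_le_N

theorem eta_notMem {j : ℕ} (h1 : 1 ≤ j) (hM : j ≤ M) : eta M q j ∉ vertexRegion q b N := fun h => by
  have := H.theta_lt_eta j
  rcases (mem_vertexRegion.mp h).2.1 j h1 hM with h' | h' <;> linarith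

/-- The points `a_i` with `i < N` lie outside the switch region. -/
theorem aPt_outside {i : ℕ} (h1 : 1 ≤ i) (hN : i < N) (j : ℕ) :
    aPt q b i < theta q j ∨ eta M q j < aPt q b i := by
  have hs := H.aPt_succ i h1 hN
  have hlt := H.aPt_lt (i + 1) (by omega) (by omega)
  have hgt := H.lt_aPt (i + 1) (by omega) (by omega)
  rcases Nat.lt_or_ge (b (i - 1) : ℕ) j with h | h
  · left
    have : ((b (i - 1) : ℕ) : ℝ) + 1 ≤ j := by exact_mod_cast h
    exact H.lt_of_mul (by rw [H.mul_theta]; linarith)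
  · right
    have : (j : ℝ) ≤ (b (i - 1) : ℕ) := by exact_mod_cast h
    exact H.lt_of_mul (by rw [H.mul_eta]; linarith)

theorem aPt_outside_left {i : ℕ} (h1 : 1 ≤ i) (hN : i ≤ N) (j : ℕ) :
    aPt q b i ≤ theta q j ∨ eta M q j < aPt q b i := by
  rcases hN.eq_or_lt with rfl | h
  · rw [H.aPt_N]
    rcases Nat.lt_or_ge j (b (i - 1) : ℕ) with h | h
    · exact Or.inr (H.eta_lt_theta h)
    · left
      apply H.le_of_mul
      rw [H.mul_theta, H.mul_theta]
      exact_mod_cast h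
  · exact (H.aPt_outside h1 h j).imp le_of_lt id

/-! ### Reflection -/

theorem reflect_mem {x : ℝ} (hx : x ∈ vertexRegion q b N) :
    M / (q - 1) - x ∈ vertexRegion q b N := by
  rw [mem_vertexRegion] at hx ⊢
  obtain ⟨⟨h0, h1⟩, h2, h3⟩ := hx
  refine ⟨⟨by linarith, by linarith⟩, fun j hj hj' => ?_, fun i hi hi' => ⟨fun h => ?_, fun h => ?_⟩⟩
  · have e1 := H.bound_sub_theta hj'
    have e2 := H.bound_sub_eta hj'
    rcases h2 (M + 1 - j) (by omega) (by omega) with h | h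
    · right; linarith
    · left; linarith
  · exact (h3 i hi hi').2 (by rw [bPt, ← h]; ring)
  · exact (h3 i hi hi').1 (by rw [bPt] at h; linarith)

theorem reflect_mem_iff {x : ℝ} :
    M / (q - 1) - x ∈ vertexRegion q b N ↔ x ∈ vertexRegion q b N :=
  ⟨fun h => by simpa using H.reflect_mem h, H.reflect_mem⟩

omit H in
/-- The interval `(c, d)` is a connected component of the vertex region contained in
`(b_1, a_1)`. -/
def IsInnerGap (q : ℝ) (b : ℕ → Fin (M + 1)) (N : ℕ) (c d : ℝ) : Prop :=
  IsGap q b N c d ∧ M / (q - 1) - 1 ≤ c ∧ d ≤ 1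

theorem reflect_gap {c d : ℝ} (h : IsInnerGap q b N c d) :
    IsInnerGap q b N (M / (q - 1) - d) (M / (q - 1) - c) := by
  obtain ⟨⟨h1, h2, h3, h4⟩, h5, h6⟩ := h
  refine ⟨⟨by linarith, by rwa [H.reflect_mem_iff], by rwa [H.reflect_mem_iff], fun x hx => ?_⟩,
    by linarith, by linarith⟩
  rw [← H.reflect_mem_iff]
  exact h4 ⟨by linarith [hx.2], by linarith [hx.1]⟩

theorem exists_gap_right {p : ℝ} (h0 : M / (q - 1) - 1 ≤ p) (h1 : p < 1)
    (hp : p ∉ vertexRegion q b N)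
    (hS : ∀ j, 1 ≤ j → j ≤ M → p < theta q j ∨ eta M q j ≤ p) : ∃ d, IsInnerGap q b N p d := by
  have hev : ∀ᶠ x in 𝓝[>] p, x ∈ vertexRegion q b N := by
    have e0 : ∀ᶠ x in 𝓝[>] p, p < x := self_mem_nhdsWithin
    have e1 : ∀ᶠ x in 𝓝[>] p, x < 1 := nhdsWithin_le_nhds (gt_mem_nhds h1)
    have e2 : ∀ᶠ x in 𝓝[>] p, ∀ j ∈ Finset.Icc 1 M, x < theta q j ∨ eta M q j < x := by
      rw [Filter.eventually_all_finset]
      intro j hj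
      rw [Finset.mem_Icc] at hj
      rcases hS j hj.1 hj.2 with h | h
      · have : ∀ᶠ x in 𝓝[>] p, x < theta q j := nhdsWithin_le_nhds (gt_mem_nhds h)
        exact this.mono fun x hx => Or.inl hx
      · exact e0.mono fun x hx => Or.inr (lt_of_le_of_lt h hx)
    have e3 : ∀ y : ℝ, ∀ᶠ x in 𝓝[>] p, x ≠ y := by
      intro y
      rcases lt_or_ge p y with h | h
      · have : ∀ᶠ x in 𝓝[>] p, x < y := nhdsWithin_le_nhds (gt_mem_nhds h)
        exact this.mono fun x hx => hx.ne
      · exact e0.mono fun x hx => (lt_of_le_of_lt h hx).ne'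
    have e4 : ∀ᶠ x in 𝓝[>] p, ∀ i ∈ Finset.Icc 1 N, x ≠ aPt q b i ∧ x ≠ bPt q b i := by
      rw [Filter.eventually_all_finset]
      exact fun i _ => (e3 _).and (e3 _)
    filter_upwards [e0, e1, e2, e4] with x x0 x1 x2 x4
    have := H.one_lt_bound
    exact mem_vertexRegion.mpr ⟨⟨by linarith, by linarith⟩,
      fun j hj hj' => x2 j (Finset.mem_Icc.mpr ⟨hj, hj'⟩),
      fun i hi hi' => x4 i (Finset.mem_Icc.mpr ⟨hi, hi'⟩)⟩
  obtain ⟨u, hu, hsub⟩ := mem_nhdsGT_iff_exists_Ioo_subset.mp hev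
  obtain ⟨x, hx⟩ := exists_between (Set.mem_Ioi.mp hu)
  obtain ⟨c, d, hg, hxI, -⟩ := exists_gap_eq_component (hsub hx)
  have hpc : p ≤ c := hg.ge_of_lt hp (hx.1.trans hxI.2)
  have hcp : c ≤ p := by
    by_contra h
    exact hg.2.1 (hsub ⟨not_le.mp h, hxI.1.trans hx.2⟩)
  obtain rfl := le_antisymm hpc hcp
  exact ⟨d, hg, h0, hg.le_of_lt H.one_notMem h1⟩

theorem exists_gap_left {p : ℝ} (h0 : M / (q - 1) - 1 < p) (h1 : p ≤ 1)
    (hp : p ∉ vertexRegion q b N)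
    (hS : ∀ j, 1 ≤ j → j ≤ M → p ≤ theta q j ∨ eta M q j < p) : ∃ c, IsInnerGap q b N c p := by
  obtain ⟨d, hd⟩ := H.exists_gap_right (p := M / (q - 1) - p) (by linarith) (by linarith)
    (by rwa [H.reflect_mem_iff]) fun j hj hj' => by
      have e1 := H.bound_sub_theta hj'
      have e2 := H.bound_sub_eta hj'
      rcases hS (M + 1 - j) (by omega) (by omega) with h | h
      · right; linarith
      · left; linarith
  refine ⟨M / (q - 1) - d, ?_⟩
  simpa using H.reflect_gap hd

theorem exists_gap_aPt {i : ℕ} (h1 : 1 ≤ i) (hN : i ≤ N) :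
    ∃ c, IsInnerGap q b N c (aPt q b i) :=
  H.exists_gap_left (H.lt_aPt i h1 hN) (H.aPt_le h1 hN) (aPt_notMem h1 hN)
    fun j _ _ => H.aPt_outside_left h1 hN j

theorem exists_gap_bPt {i : ℕ} (h1 : 1 ≤ i) (hN : i ≤ N) :
    ∃ d, IsInnerGap q b N (bPt q b i) d := by
  obtain ⟨c, hc⟩ := H.exists_gap_aPt h1 hN
  exact ⟨_, H.reflect_gap hc⟩

/-! ### Images of gaps -/

omit H in
/-- The map `x ↦ q x - k` sends `(c, d)` into `(b_1, a_1)`. -/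
def IsDigit (q : ℝ) (M : ℕ) (c d : ℝ) (k : ℕ) : Prop :=
  k ≤ M ∧ M / (q - 1) - 1 ≤ q * c - k ∧ q * d - k ≤ 1

omit H in
theorem left_outside {c d : ℝ} (h : IsInnerGap q b N c d) {j : ℕ} (h1 : 1 ≤ j) (hM : j ≤ M) :
    c < theta q j ∨ eta M q j ≤ c := by
  by_contra hcon
  push Not at hcon
  obtain ⟨x, hx1, hx2⟩ := exists_between (lt_min h.1.1 hcon.2)
  rw [lt_min_iff] at hx2
  rcases (mem_vertexRegion.mp (h.1.2.2.2 ⟨hx1, hx2.1⟩)).2.1 j h1 hM with h' | h' <;> linarith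

theorem exists_digit {c d : ℝ} (h : IsInnerGap q b N c d) : ∃ k, IsDigit q M c d k := by
  have hL := H.one_lt_bound
  have hc0 : 0 < c := by linarith [h.2.1]
  have hc1 : c < 1 := by linarith [h.2.2, h.1.1]
  have hqc : 0 < q * c := mul_pos H.pos hc0
  have f1 := Nat.floor_le hqc.le
  have f2 := Nat.lt_floor_add_one (q * c)
  have hqc1 : q * c < M + 1 := by nlinarith [H.lt_add_one, H.pos]
  have hk : ⌊q * c⌋₊ ≤ M :=
    Nat.lt_succ_iff.mp ((Nat.floor_lt hqc.le).mpr (by push_cast; exact hqc1))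
  refine ⟨⌊q * c⌋₊, hk, ?_, ?_⟩
  · rcases Nat.eq_zero_or_pos ⌊q * c⌋₊ with h0 | h0
    · rw [h0]
      push_cast
      nlinarith [H.one_lt, h.2.1]
    · rcases left_outside h h0 hk with h' | h'
      · have := mul_lt_mul_of_pos_left h' H.pos
        rw [H.mul_theta] at this
        linarith
      · have := mul_le_mul_of_nonneg_left h' H.pos.le
        rw [H.mul_eta] at this
        linarith
  · rcases hk.eq_or_lt with h0 | h0
    · rw [h0]
      nlinarith [H.lt_add_one, H.pos, h.2.2]
    · by_contra hcon
      have e1 := H.mul_theta (⌊q * c⌋₊ + 1)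
      push_cast at e1
      have e2 : c < theta q (⌊q * c⌋₊ + 1) := H.lt_of_mul (by rw [e1]; exact f2)
      have e3 : theta q (⌊q * c⌋₊ + 1) < d := H.lt_of_mul (by rw [e1]; linarith)
      have := H.theta_lt_eta (⌊q * c⌋₊ + 1)
      rcases (mem_vertexRegion.mp (h.1.2.2.2 ⟨e2, e3⟩)).2.1 _ (by omega) h0 with h' | h' <;>
        linarith

/-- The interval `[b_1, a_1]` is shorter than `1`, so that it contains at most one of the points
`x - k` with integer `k`. -/
theorem sub_eq {x v : ℝ} {k m : ℕ} (h0 : M / (q - 1) - 1 ≤ x - k) (h1 : x - k ≤ 1)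
    (hv : x - m = v) (hv0 : M / (q - 1) - 1 ≤ v) (hv1 : v ≤ 1) : x - k = v := by
  have hL := H.one_lt_bound
  have e1 : (k : ℝ) < m + 1 := by linarith
  have e2 : (m : ℝ) < k + 1 := by linarith
  have e3 : k < m + 1 := by exact_mod_cast e1
  have e4 : m < k + 1 := by exact_mod_cast e2
  obtain rfl : k = m := by omega
  exact hv

theorem reflect_digit {c d : ℝ} {k : ℕ} (hk : IsDigit q M c d k) :
    IsDigit q M (M / (q - 1) - d) (M / (q - 1) - c) (M - k) := by
  obtain ⟨h0, h1, h2⟩ := hk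
  refine ⟨by omega, ?_, ?_⟩ <;> rw [Nat.cast_sub h0, mul_sub, H.mul_bound] <;> linarith

theorem aPt_image {i : ℕ} (h1 : 1 ≤ i) (hN : i < N) {k : ℕ}
    (hk0 : M / (q - 1) - 1 ≤ q * aPt q b i - k) (hk1 : q * aPt q b i - k ≤ 1) :
    q * aPt q b i - k = aPt q b (i + 1) :=
  H.sub_eq hk0 hk1 (H.aPt_succ i h1 hN) (H.lt_aPt _ (by omega) (by omega)).le
    (H.aPt_le (by omega) (by omega))

theorem bPt_image {i : ℕ} (h1 : 1 ≤ i) (hN : i < N) {k : ℕ}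
    (hk0 : M / (q - 1) - 1 ≤ q * bPt q b i - k) (hk1 : q * bPt q b i - k ≤ 1) :
    q * bPt q b i - k = bPt q b (i + 1) := by
  have e1 := (H.lt_aPt (i + 1) (by omega) (by omega)).le
  have e2 := H.aPt_le (i := i + 1) (by omega) (by omega)
  refine H.sub_eq hk0 hk1 (H.bPt_succ i h1 hN) ?_ ?_ <;> rw [bPt] <;> linarith

/-- The possible left endpoints of the inner gaps and their images. -/
theorem left_cases {c d : ℝ} {k : ℕ} (h : IsInnerGap q b N c d) (hk : IsDigit q M c d k) :
    (∃ j, 1 ≤ j ∧ j ≤ M ∧ c = eta M q j ∧ q * c - k = bPt q b 1) ∨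
    (∃ i, 1 ≤ i ∧ i < N ∧ c = aPt q b i ∧ q * c - k = aPt q b (i + 1)) ∨
    (∃ i, 1 ≤ i ∧ i < N ∧ c = bPt q b i ∧ q * c - k = bPt q b (i + 1)) := by
  have hL := H.one_lt_bound
  have hL2 := H.bound_lt_two
  have hcd : q * c < q * d := mul_lt_mul_of_pos_left h.1.1 H.pos
  have hk1 : q * c - k ≤ 1 := by linarith [hk.2.2]
  have heta : ∀ j, 1 ≤ j → j ≤ M → c = eta M q j →
      (∃ j, 1 ≤ j ∧ j ≤ M ∧ c = eta M q j ∧ q * c - k = bPt q b 1) := by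
    intro j hj hj' hc
    refine ⟨j, hj, hj', hc, ?_⟩
    rw [H.bPt_one]
    refine H.sub_eq (m := j) hk.2.1 hk1 ?_ le_rfl (by linarith)
    rw [hc, H.mul_eta]
    ring
  by_cases hS : ∃ j, 1 ≤ j ∧ j ≤ M ∧ theta q j ≤ c ∧ c ≤ eta M q j
  · obtain ⟨j, hj, hj', hc1, hc2⟩ := hS
    rcases left_outside h hj hj' with h' | h'
    · linarith
    · exact Or.inl (heta j hj hj' (le_antisymm hc2 h'))
  by_cases hP : ∃ i, 1 ≤ i ∧ i ≤ N ∧ (c = aPt q b i ∨ c = bPt q b i)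
  · obtain ⟨i, hi, hi', hc | hc⟩ := hP
    · rcases hi'.eq_or_lt with rfl | hlt
      · exact absurd ⟨(b (i - 1) : ℕ), H.one_le_last, digit_le _, by rw [hc, H.aPt_N],
          by rw [hc, H.aPt_N]; exact (H.theta_lt_eta _).le⟩ hS
      · right; left
        refine ⟨i, hi, hlt, hc, ?_⟩
        rw [hc] at hk1 ⊢
        exact H.aPt_image hi hlt (hc ▸ hk.2.1) hk1
    · rcases hi'.eq_or_lt with rfl | hlt
      · have := H.one_le_last
        have := digit_le (b := b) (i - 1)
        exact Or.inl (heta (M + 1 - (b (i - 1) : ℕ)) (by omega) (by omega) (by rw [hc, H.bPt_N]))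
      · right; right
        refine ⟨i, hi, hlt, hc, ?_⟩
        rw [hc] at hk1 ⊢
        exact H.bPt_image hi hlt (hc ▸ hk.2.1) hk1
  · exfalso
    push Not at hS hP
    refine h.1.2.1 (mem_vertexRegion.mpr ⟨⟨by linarith [h.2.1], by linarith [h.2.2, h.1.1]⟩,
      fun j hj hj' => ?_, fun i hi hi' => hP i hi hi'⟩)
    rcases lt_or_ge c (theta q j) with h' | h'
    · exact Or.inl h'
    · exact Or.inr (hS j hj hj' h')

theorem right_cases {c d : ℝ} {k : ℕ} (h : IsInnerGap q b N c d) (hk : IsDigit q M c d k) :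
    (∃ j, 1 ≤ j ∧ j ≤ M ∧ d = theta q j ∧ q * d - k = aPt q b 1) ∨
    (∃ i, 1 ≤ i ∧ i < N ∧ d = bPt q b i ∧ q * d - k = bPt q b (i + 1)) ∨
    (∃ i, 1 ≤ i ∧ i < N ∧ d = aPt q b i ∧ q * d - k = aPt q b (i + 1)) := by
  have e : q * (M / (q - 1) - d) - (M - k : ℕ) = M / (q - 1) - (q * d - k) := by
    rw [Nat.cast_sub hk.1, mul_sub, H.mul_bound]; ring
  rcases H.left_cases (H.reflect_gap h) (H.reflect_digit hk) with
    ⟨j, h1, h2, h3, h4⟩ | ⟨i, h1, h2, h3, h4⟩ | ⟨i, h1, h2, h3, h4⟩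
  · left
    refine ⟨M + 1 - j, by omega, by omega, ?_, ?_⟩
    · rw [← H.bound_sub_eta h2, ← h3]; ring
    · rw [e, bPt] at h4; linarith
  · right; left
    refine ⟨i, h1, h2, ?_, ?_⟩
    · rw [bPt, ← h3]; ring
    · rw [e] at h4; rw [bPt, ← h4]; ring
  · right; right
    refine ⟨i, h1, h2, ?_, ?_⟩
    · rw [bPt] at h3; linarith
    · rw [e, bPt] at h4; linarith

theorem left_image_notMem {c d : ℝ} {k : ℕ} (h : IsInnerGap q b N c d) (hk : IsDigit q M c d k) :
    q * c - k ∉ vertexRegion q b N := by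
  rcases H.left_cases h hk with ⟨j, -, -, -, h4⟩ | ⟨i, h1, h2, -, h4⟩ | ⟨i, h1, h2, -, h4⟩ <;>
    rw [h4]
  · exact bPt_notMem le_rfl H.one_le_N
  · exact aPt_notMem (by omega) (by omega)
  · exact bPt_notMem (by omega) (by omega)

theorem right_image_notMem {c d : ℝ} {k : ℕ} (h : IsInnerGap q b N c d) (hk : IsDigit q M c d k) :
    q * d - k ∉ vertexRegion q b N := by
  rcases H.right_cases h hk with ⟨j, -, -, -, h4⟩ | ⟨i, h1, h2, -, h4⟩ | ⟨i, h1, h2, -, h4⟩ <;>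
    rw [h4]
  · exact aPt_notMem le_rfl H.one_le_N
  · exact bPt_notMem (by omega) (by omega)
  · exact aPt_notMem (by omega) (by omega)

/-! ### Vertices, edges and paths in terms of endpoints -/

omit H in
/-- The interval `(c, d)` ends at some `a_i` or starts at some `b_i`. -/
def IsOne (q : ℝ) (b : ℕ → Fin (M + 1)) (N : ℕ) (c d : ℝ) : Prop :=
  (∃ i, 1 ≤ i ∧ i ≤ N ∧ d = aPt q b i) ∨ ∃ i, 1 ≤ i ∧ i ≤ N ∧ c = bPt q b i

omit H in
theorem reflect_one {c d : ℝ} (h : IsOne q b N c d) :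
    IsOne q b N (M / (q - 1) - d) (M / (q - 1) - c) := by
  rcases h with ⟨i, h1, h2, rfl⟩ | ⟨i, h1, h2, rfl⟩
  · exact Or.inr ⟨i, h1, h2, rfl⟩
  · exact Or.inl ⟨i, h1, h2, by rw [bPt]; ring⟩

theorem mem_verts {I : Set ℝ} : I ∈ (tildeGraph q b N).verts ↔
    ∃ c d, IsInnerGap q b N c d ∧ I = Set.Ioo c d := by
  change ((∃ x ∈ vertexRegion q b N, I = connectedComponentIn (vertexRegion q b N) x) ∧
    I ⊆ Set.Ioo (bPt q b 1) (aPt q b 1)) ↔ _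
  rw [isVertex_iff, H.bPt_one, H.aPt_one]
  constructor
  · rintro ⟨⟨c, d, h, rfl⟩, hI⟩
    rw [Set.Ioo_subset_Ioo_iff h.1] at hI
    exact ⟨c, d, ⟨h, hI⟩, rfl⟩
  · rintro ⟨c, d, h, rfl⟩
    exact ⟨⟨c, d, h.1, rfl⟩, Set.Ioo_subset_Ioo h.2.1 h.2.2⟩

theorem image_Ioo (c d : ℝ) (k : ℕ) :
    (fun x : ℝ => q * x - (k : ℝ)) '' Set.Ioo c d = Set.Ioo (q * c - k) (q * d - k) := by
  have h0 := H.pos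
  ext y
  constructor
  · rintro ⟨x, ⟨h1, h2⟩, rfl⟩
    have := mul_lt_mul_of_pos_left h1 h0
    have := mul_lt_mul_of_pos_left h2 h0
    constructor <;> dsimp only <;> linarith
  · rintro ⟨h1, h2⟩
    have e : q * ((y + k) / q) = y + k := by field_simp
    exact ⟨(y + k) / q, ⟨H.lt_of_mul (by linarith), H.lt_of_mul (by linarith)⟩,
      by dsimp only; linarith⟩

theorem mem_edges {I J : Set ℝ} {k : Fin (M + 1)} : (I, k, J) ∈ (tildeGraph q b N).edges ↔
    ∃ c d c' d', IsInnerGap q b N c d ∧ IsInnerGap q b N c' d' ∧ I = Set.Ioo c d ∧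
      J = Set.Ioo c' d' ∧ q * c - (k : ℕ) ≤ c' ∧ d' ≤ q * d - (k : ℕ) := by
  have hI : ∀ I, I ∈ (tildeGraph q b N).verts ↔
      (∃ x ∈ vertexRegion q b N, I = connectedComponentIn (vertexRegion q b N) x) ∧
        I ⊆ Set.Ioo (bPt q b 1) (aPt q b 1) := fun I => Iff.rfl
  change (((∃ x ∈ vertexRegion q b N, I = connectedComponentIn (vertexRegion q b N) x) ∧
    (∃ y ∈ vertexRegion q b N, J = connectedComponentIn (vertexRegion q b N) y) ∧
    J ⊆ (fun x : ℝ => q * x - ((k : ℕ) : ℝ)) '' I) ∧ I ⊆ Set.Ioo (bPt q b 1) (aPt q b 1) ∧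
      J ⊆ Set.Ioo (bPt q b 1) (aPt q b 1)) ↔ _
  constructor
  · rintro ⟨⟨h1, h2, h3⟩, h4, h5⟩
    obtain ⟨c, d, h, rfl⟩ := H.mem_verts.mp ((hI I).mpr ⟨h1, h4⟩)
    obtain ⟨c', d', h', rfl⟩ := H.mem_verts.mp ((hI J).mpr ⟨h2, h5⟩)
    rw [H.image_Ioo, Set.Ioo_subset_Ioo_iff h'.1.1] at h3
    exact ⟨c, d, c', d', h, h', rfl, rfl, h3⟩
  · rintro ⟨c, d, c', d', h, h', rfl, rfl, h3⟩
    have e1 := (hI _).mp (H.mem_verts.mpr ⟨c, d, h, rfl⟩)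
    have e2 := (hI _).mp (H.mem_verts.mpr ⟨c', d', h', rfl⟩)
    refine ⟨⟨e1.1, e2.1, ?_⟩, e1.2, e2.2⟩
    rw [H.image_Ioo]
    exact Set.Ioo_subset_Ioo h3.1 h3.2

omit H in
/-- The condition that cuts `tildeGraphOne` out of `tildeGraph`. -/
def oneSet (q : ℝ) (b : ℕ → Fin (M + 1)) (N : ℕ) : Set (Set ℝ) :=
  {I | (∃ i ∈ Set.Icc 1 N, ∃ c, I = Set.Ioo c (aPt q b i)) ∨
    (∃ i ∈ Set.Icc 1 N, ∃ d, I = Set.Ioo (bPt q b i) d)}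

omit H in
theorem mem_oneSet {c d : ℝ} (hcd : c < d) : Set.Ioo c d ∈ oneSet q b N ↔ IsOne q b N c d := by
  constructor
  · rintro (⟨i, hi, c', he⟩ | ⟨i, hi, d', he⟩)
    · exact Or.inl ⟨i, hi.1, hi.2, (Ioo_inj hcd he).2⟩
    · exact Or.inr ⟨i, hi.1, hi.2, (Ioo_inj hcd he).1⟩
  · rintro (⟨i, h1, h2, rfl⟩ | ⟨i, h1, h2, rfl⟩)
    · exact Or.inl ⟨i, ⟨h1, h2⟩, c, rfl⟩
    · exact Or.inr ⟨i, ⟨h1, h2⟩, d, rfl⟩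

theorem mem_verts_one {I : Set ℝ} : I ∈ (tildeGraphOne q b N).verts ↔
    ∃ c d, IsInnerGap q b N c d ∧ IsOne q b N c d ∧ I = Set.Ioo c d := by
  change (I ∈ (tildeGraph q b N).verts ∧ I ∈ oneSet q b N) ↔ _
  rw [H.mem_verts]
  constructor
  · rintro ⟨⟨c, d, h, rfl⟩, h'⟩
    exact ⟨c, d, h, (mem_oneSet h.1.1).mp h', rfl⟩
  · rintro ⟨c, d, h, h', rfl⟩
    exact ⟨⟨c, d, h, rfl⟩, (mem_oneSet h.1.1).mpr h'⟩

omit H in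
theorem mem_edges_one {e : Set ℝ × Fin (M + 1) × Set ℝ} : e ∈ (tildeGraphOne q b N).edges ↔
    e ∈ (tildeGraph q b N).edges ∧ e.1 ∈ oneSet q b N ∧ e.2.2 ∈ oneSet q b N := Iff.rfl

omit H in
theorem hasPath_of_one {I J : Set ℝ} (h : (tildeGraphOne q b N).HasPath I J) :
    (tildeGraph q b N).HasPath I J :=
  Relation.ReflTransGen.mono (fun _ _ ⟨k, hk⟩ => ⟨k, (mem_edges_one.mp hk).1⟩) _ _ h

/-- A gap meeting the image of another one is contained in it, because the endpoints of the image
lie outside the vertex region. -/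
theorem edge_of_overlap {c d c' d' : ℝ} {k : ℕ} (h : IsInnerGap q b N c d)
    (h' : IsInnerGap q b N c' d') (hk : IsDigit q M c d k) (h1 : q * c - k < d')
    (h2 : c' < q * d - k) :
    (Set.Ioo c d, (⟨k, Nat.lt_succ_of_le hk.1⟩ : Fin (M + 1)), Set.Ioo c' d') ∈
      (tildeGraph q b N).edges :=
  H.mem_edges.mpr ⟨c, d, c', d', h, h', rfl, rfl, h'.1.ge_of_lt (H.left_image_notMem h hk) h1,
    h'.1.le_of_lt (H.right_image_notMem h hk) h2⟩

theorem path_of_overlap {c d c' d' : ℝ} {k : ℕ} (h : IsInnerGap q b N c d)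
    (h' : IsInnerGap q b N c' d') (hk : IsDigit q M c d k) (h1 : q * c - k < d')
    (h2 : c' < q * d - k) : (tildeGraph q b N).HasPath (Set.Ioo c d) (Set.Ioo c' d') :=
  Relation.ReflTransGen.single ⟨_, H.edge_of_overlap h h' hk h1 h2⟩

theorem path_one_of_overlap {c d c' d' : ℝ} {k : ℕ} (h : IsInnerGap q b N c d)
    (h' : IsInnerGap q b N c' d') (ho : IsOne q b N c d) (ho' : IsOne q b N c' d')
    (hk : IsDigit q M c d k) (h1 : q * c - k < d') (h2 : c' < q * d - k) :
    (tildeGraphOne q b N).HasPath (Set.Ioo c d) (Set.Ioo c' d') :=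
  Relation.ReflTransGen.single ⟨_, mem_edges_one.mpr ⟨H.edge_of_overlap h h' hk h1 h2,
    (mem_oneSet h.1.1).mpr ho, (mem_oneSet h'.1.1).mpr ho'⟩⟩

omit H in
/-- The reflection in the midpoint of `(0, M / (q - 1))`. -/
def reflect (M : ℕ) (q : ℝ) (I : Set ℝ) : Set ℝ := (fun x => M / (q - 1) - x) '' I

omit H in
theorem reflect_Ioo (c d : ℝ) :
    reflect M q (Set.Ioo c d) = Set.Ioo (M / (q - 1) - d) (M / (q - 1) - c) :=
  Set.image_const_sub_Ioo _ _ _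

theorem reflect_edge {I J : Set ℝ} {k : Fin (M + 1)} (h : (I, k, J) ∈ (tildeGraph q b N).edges) :
    (reflect M q I, k.rev, reflect M q J) ∈ (tildeGraph q b N).edges := by
  obtain ⟨c, d, c', d', h1, h2, rfl, rfl, h3, h4⟩ := H.mem_edges.mp h
  refine H.mem_edges.mpr ⟨_, _, _, _, H.reflect_gap h1, H.reflect_gap h2, reflect_Ioo _ _,
    reflect_Ioo _ _, ?_⟩
  have e : ((k.rev : ℕ) : ℝ) = M - (k : ℕ) := by
    rw [Fin.val_rev, show M + 1 - ((k : ℕ) + 1) = M - k by omega,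
      Nat.cast_sub (Nat.lt_succ_iff.mp k.isLt)]
  rw [e, mul_sub, mul_sub, H.mul_bound]
  constructor <;> linarith

omit H in
omit H in
theorem reflect_oneSet {I : Set ℝ} (hI : I ∈ oneSet q b N) : reflect M q I ∈ oneSet q b N := by
  rcases hI with ⟨i, hi, c, rfl⟩ | ⟨i, hi, d, rfl⟩
  · exact Or.inr ⟨i, hi, _, reflect_Ioo _ _⟩
  · exact Or.inl ⟨i, hi, _, by rw [reflect_Ioo, bPt, sub_sub_cancel]⟩

theorem reflect_path {I J : Set ℝ} (h : (tildeGraph q b N).HasPath I J) :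
    (tildeGraph q b N).HasPath (reflect M q I) (reflect M q J) :=
  Relation.ReflTransGen.lift (reflect M q) (fun _ _ ⟨k, hk⟩ => ⟨k.rev, H.reflect_edge hk⟩) _ _ h

theorem reflect_path_one {I J : Set ℝ} (h : (tildeGraphOne q b N).HasPath I J) :
    (tildeGraphOne q b N).HasPath (reflect M q I) (reflect M q J) :=
  Relation.ReflTransGen.lift (reflect M q) (fun _ _ ⟨k, hk⟩ => ⟨k.rev, mem_edges_one.mpr
    ⟨H.reflect_edge (mem_edges_one.mp hk).1, reflect_oneSet (mem_edges_one.mp hk).2.1,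
      reflect_oneSet (mem_edges_one.mp hk).2.2⟩⟩) _ _ h

/-! ### Strong connectivity of the subgraph of the `a_i` and `b_i` -/

omit H in
theorem isOne_aPt {i : ℕ} (h1 : 1 ≤ i) (hN : i ≤ N) (c : ℝ) : IsOne q b N c (aPt q b i) :=
  Or.inl ⟨i, h1, hN, rfl⟩

omit H in
theorem isOne_bPt {i : ℕ} (h1 : 1 ≤ i) (hN : i ≤ N) (d : ℝ) : IsOne q b N (bPt q b i) d :=
  Or.inr ⟨i, h1, hN, rfl⟩

/-- A gap leads to the gap whose right endpoint is the image of its right endpoint. -/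
theorem path_one_right {c d c' : ℝ} {k : ℕ} (h : IsInnerGap q b N c d) (ho : IsOne q b N c d)
    (hk : IsDigit q M c d k) (h' : IsInnerGap q b N c' (q * d - k))
    (ho' : IsOne q b N c' (q * d - k)) :
    (tildeGraphOne q b N).HasPath (Set.Ioo c d) (Set.Ioo c' (q * d - k)) :=
  H.path_one_of_overlap h h' ho ho' hk
    (by linarith [mul_lt_mul_of_pos_left h.1.1 H.pos]) h'.1.1

theorem path_aPt_succ {i : ℕ} (h1 : 1 ≤ i) (hN : i < N) {c c' : ℝ}
    (h : IsInnerGap q b N c (aPt q b i)) (h' : IsInnerGap q b N c' (aPt q b (i + 1))) :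
    (tildeGraphOne q b N).HasPath (Set.Ioo c (aPt q b i)) (Set.Ioo c' (aPt q b (i + 1))) := by
  obtain ⟨k, hk⟩ := H.exists_digit h
  have e := H.aPt_image h1 hN (k := k)
    (by linarith [mul_lt_mul_of_pos_left h.1.1 H.pos, hk.2.1]) hk.2.2
  rw [← e] at h' ⊢
  exact H.path_one_right h (isOne_aPt h1 hN.le c) hk h'
    (e ▸ isOne_aPt (by omega) (by omega) c')

theorem path_aPt_last {c c' : ℝ} (h : IsInnerGap q b N c (aPt q b N))
    (h' : IsInnerGap q b N c' (aPt q b 1)) :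
    (tildeGraphOne q b N).HasPath (Set.Ioo c (aPt q b N)) (Set.Ioo c' (aPt q b 1)) := by
  obtain ⟨k, hk⟩ := H.exists_digit h
  have h1 := H.one_le_last
  have e : q * aPt q b N - k = aPt q b 1 := by
    rw [H.aPt_one]
    refine H.sub_eq (m := (b (N - 1) : ℕ) - 1)
      (by linarith [mul_lt_mul_of_pos_left h.1.1 H.pos, hk.2.1]) hk.2.2 ?_
      (by linarith [H.bound_lt_two]) le_rfl
    rw [H.aPt_last]
    push_cast [h1]
    ring
  rw [← e] at h' ⊢
  exact H.path_one_right h (isOne_aPt H.one_le_N le_rfl c) hk h'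
    (e ▸ isOne_aPt le_rfl H.one_le_N c')

theorem path_aPt_aPt {i j : ℕ} (hi : 1 ≤ i) (hiN : i ≤ N) (hj : 1 ≤ j) (hjN : j ≤ N) {c c' : ℝ}
    (h : IsInnerGap q b N c (aPt q b i)) (h' : IsInnerGap q b N c' (aPt q b j)) :
    (tildeGraphOne q b N).HasPath (Set.Ioo c (aPt q b i)) (Set.Ioo c' (aPt q b j)) := by
  have up : ∀ n i, 1 ≤ i → i + n ≤ N → ∀ c c', IsInnerGap q b N c (aPt q b i) →
      IsInnerGap q b N c' (aPt q b (i + n)) →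
      (tildeGraphOne q b N).HasPath (Set.Ioo c (aPt q b i)) (Set.Ioo c' (aPt q b (i + n))) := by
    intro n
    induction n with
    | zero =>
      intro i _ _ c c' h h'
      obtain ⟨rfl, -⟩ := h.1.eq_of_overlap h'.1 h.1.1 h'.1.1
      exact Relation.ReflTransGen.refl
    | succ n ih =>
      intro i h1 hN c c' h h'
      obtain ⟨c'', h''⟩ := H.exists_gap_aPt (i := i + n) (by omega) (by omega)
      exact (ih i h1 (by omega) c c'' h h'').trans
        (H.path_aPt_succ (by omega) (by omega) h'' h')
  obtain ⟨cN, hcN⟩ := H.exists_gap_aPt H.one_le_N le_rfl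
  obtain ⟨c1, hc1⟩ := H.exists_gap_aPt le_rfl H.one_le_N
  have e1 := up (N - i) i hi (by omega) c cN h (by rwa [Nat.add_sub_of_le hiN])
  rw [Nat.add_sub_of_le hiN] at e1
  have e2 := up (j - 1) 1 le_rfl (by omega) c1 c' hc1 (by rwa [Nat.add_sub_of_le hj])
  rw [Nat.add_sub_of_le hj] at e2
  exact e1.trans ((H.path_aPt_last hcN hc1).trans e2)

theorem path_bPt_bPt {i j : ℕ} (hi : 1 ≤ i) (hiN : i ≤ N) (hj : 1 ≤ j) (hjN : j ≤ N) {d d' : ℝ}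
    (h : IsInnerGap q b N (bPt q b i) d) (h' : IsInnerGap q b N (bPt q b j) d') :
    (tildeGraphOne q b N).HasPath (Set.Ioo (bPt q b i) d) (Set.Ioo (bPt q b j) d') := by
  have h1 := H.reflect_gap h
  have h1' := H.reflect_gap h'
  rw [bPt, sub_sub_cancel] at h1 h1'
  have := H.reflect_path_one (H.path_aPt_aPt hi hiN hj hjN h1 h1')
  rw [reflect_Ioo, reflect_Ioo, sub_sub_cancel, sub_sub_cancel] at this
  exact this

/-- The gap below the smallest of the points `a_i` cannot start at one of these points, so it
starts at some `b_j` or at some `η_j`; in the latter case its image starts at `b_1`. -/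
theorem exists_path_aPt_bPt : ∃ i j c d, (1 ≤ i ∧ i ≤ N) ∧ (1 ≤ j ∧ j ≤ N) ∧
    IsInnerGap q b N c (aPt q b i) ∧ IsInnerGap q b N (bPt q b j) d ∧
    (tildeGraphOne q b N).HasPath (Set.Ioo c (aPt q b i)) (Set.Ioo (bPt q b j) d) := by
  obtain ⟨i, hi, hmin⟩ := Finset.exists_min_image (Finset.Icc 1 N) (aPt q b)
    ⟨1, Finset.mem_Icc.mpr ⟨le_rfl, H.one_le_N⟩⟩
  rw [Finset.mem_Icc] at hi
  obtain ⟨c, hc⟩ := H.exists_gap_aPt hi.1 hi.2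
  obtain ⟨k, hk⟩ := H.exists_digit hc
  rcases H.left_cases hc hk with ⟨j, -, -, -, h4⟩ | ⟨j, h1, h2, h3, -⟩ | ⟨j, h1, h2, rfl, -⟩
  · obtain ⟨d, hd⟩ := H.exists_gap_bPt le_rfl H.one_le_N
    refine ⟨i, 1, c, d, hi, ⟨le_rfl, H.one_le_N⟩, hc, hd, ?_⟩
    refine H.path_one_of_overlap hc hd (isOne_aPt hi.1 hi.2 c) (isOne_bPt le_rfl H.one_le_N d) hk
      (h4 ▸ hd.1.1) ?_
    rw [← h4]
    linarith [mul_lt_mul_of_pos_left hc.1.1 H.pos]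
  · have := hmin j (Finset.mem_Icc.mpr ⟨h1, h2.le⟩)
    have := hc.1.1
    linarith
  · exact ⟨i, j, _, _, hi, ⟨h1, h2.le⟩, hc, hc, Relation.ReflTransGen.refl⟩

theorem stronglyConnected_one : (tildeGraphOne q b N).StronglyConnected := by
  obtain ⟨i, j, c, d, hi, hj, hc, hd, hp⟩ := H.exists_path_aPt_bPt
  have hp' := H.reflect_path_one hp
  rw [reflect_Ioo, reflect_Ioo, bPt, sub_sub_cancel] at hp'
  have hc' : IsInnerGap q b N (bPt q b i) _ := H.reflect_gap hc
  have hd' := H.reflect_gap hd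
  rw [bPt, sub_sub_cancel] at hd'
  intro I hI J hJ
  obtain ⟨u, v, h, ho, rfl⟩ := H.mem_verts_one.mp hI
  obtain ⟨u', v', h', ho', rfl⟩ := H.mem_verts_one.mp hJ
  rcases ho with ⟨m, hm, hmN, rfl⟩ | ⟨m, hm, hmN, rfl⟩ <;>
    rcases ho' with ⟨n, hn, hnN, rfl⟩ | ⟨n, hn, hnN, rfl⟩
  · exact H.path_aPt_aPt hm hmN hn hnN h h'
  · exact (H.path_aPt_aPt hm hmN hi.1 hi.2 h hc).trans
      (hp.trans (H.path_bPt_bPt hj.1 hj.2 hn hnN hd h'))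
  · exact (H.path_bPt_bPt hm hmN hi.1 hi.2 h hc').trans
      (hp'.trans (H.path_aPt_aPt hj.1 hj.2 hn hnN hd' h'))
  · exact H.path_bPt_bPt hm hmN hn hnN h h'

/-! ### Paths into the subgraph of the `a_i` and `b_i` -/

omit H in
/-- There is a path from `(c, d)` to a vertex of `tildeGraphOne`. -/
def ReachesOne (q : ℝ) (b : ℕ → Fin (M + 1)) (N : ℕ) (c d : ℝ) : Prop :=
  ∃ c' d', IsInnerGap q b N c' d' ∧ IsOne q b N c' d' ∧
    (tildeGraph q b N).HasPath (Set.Ioo c d) (Set.Ioo c' d')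

theorem reachesOne_eta {c d : ℝ} {k : ℕ} (h : IsInnerGap q b N c d) (hk : IsDigit q M c d k)
    (he : q * c - k = bPt q b 1) : ReachesOne q b N c d := by
  obtain ⟨d', hd'⟩ := H.exists_gap_bPt le_rfl H.one_le_N
  refine ⟨_, _, hd', isOne_bPt le_rfl H.one_le_N d', H.path_of_overlap h hd' hk (he ▸ hd'.1.1) ?_⟩
  rw [← he]
  linarith [mul_lt_mul_of_pos_left h.1.1 H.pos]

theorem reachesOne_theta {c d : ℝ} {k : ℕ} (h : IsInnerGap q b N c d) (hk : IsDigit q M c d k)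
    (he : q * d - k = aPt q b 1) : ReachesOne q b N c d := by
  obtain ⟨c', hc'⟩ := H.exists_gap_aPt le_rfl H.one_le_N
  refine ⟨_, _, hc', isOne_aPt le_rfl H.one_le_N c', H.path_of_overlap h hc' hk ?_ (he ▸ hc'.1.1)⟩
  rw [← he]
  linarith [mul_lt_mul_of_pos_left h.1.1 H.pos]

/-- The image of a gap `(a_i, b_l)` contains a vertex. If its endpoints are `a_N = θ_β` and
`b_N = η_{M + 1 - β}`, where `β` is the last digit, then `i = l` and `M` is twice the digit of
index `i`. So `θ_β` and `η_{M + 1 - β}` are not the endpoints of the same switch interval, and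
there is a vertex to the right of `η_β`. -/
theorem exists_gap_in_image {i l k : ℕ} (hi : 1 ≤ i) (hiN : i < N) (hl : 1 ≤ l) (hlN : l < N)
    (hlt : aPt q b i < bPt q b l)
    (h1 : q * aPt q b i - k = aPt q b (i + 1)) (h2 : q * bPt q b l - k = bPt q b (l + 1)) :
    ∃ c d, IsInnerGap q b N c d ∧ aPt q b (i + 1) < d ∧ c < bPt q b (l + 1) := by
  have huv : aPt q b (i + 1) < bPt q b (l + 1) := by
    rw [← h1, ← h2]
    linarith [mul_lt_mul_of_pos_left hlt H.pos]
  have hbl : bPt q b (l + 1) < 1 := by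
    have := H.lt_aPt (l + 1) (by omega) (by omega)
    rw [bPt]; linarith
  have hga := H.lt_aPt (i + 1) (by omega) (by omega)
  rcases Nat.lt_or_ge (i + 1) N with hi' | hi'
  · obtain ⟨d, hd⟩ := H.exists_gap_right hga.le (huv.trans hbl)
      (aPt_notMem (by omega) hi'.le)
      fun j _ _ => (H.aPt_outside (by omega) hi' j).imp id le_of_lt
    exact ⟨_, d, hd, hd.1.1, huv⟩
  rcases Nat.lt_or_ge (l + 1) N with hl' | hl'
  · obtain ⟨d, hd⟩ := H.exists_gap_right (p := aPt q b (l + 1))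
      (H.lt_aPt _ (by omega) hl'.le).le (H.aPt_lt _ (by omega) hl'.le)
      (aPt_notMem (by omega) hl'.le)
      fun j _ _ => (H.aPt_outside (by omega) hl' j).imp id le_of_lt
    have hr : IsInnerGap q b N _ (bPt q b (l + 1)) := H.reflect_gap hd
    exact ⟨_, _, hr, huv, hr.1.1⟩
  obtain rfl : i = l := by omega
  obtain rfl : N = i + 1 := by omega
  have hM : M = 2 * k := by
    have e : q * (aPt q b i + bPt q b i) - 2 * k = aPt q b (i + 1) + bPt q b (i + 1) := by
      rw [← h1, ← h2]; ring
    rw [bPt, bPt, add_sub_cancel, add_sub_cancel, H.mul_bound] at e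
    have : (M : ℝ) = 2 * k := by linarith
    exact_mod_cast this
  have hβ := H.one_le_last
  have hβM := digit_le (b := b) (i + 1 - 1)
  have eN := H.aPt_N
  have eN' := H.bPt_N
  set β := (b (i + 1 - 1) : ℕ)
  have hβk : β ≤ k := by
    by_contra hcon
    have := H.eta_lt_theta (i := M + 1 - β) (j := β) (by omega)
    linarith
  have h3 : eta M q β < bPt q b (i + 1) := by
    rw [eN']
    apply H.lt_of_mul
    rw [H.mul_eta, H.mul_eta]
    have : (β : ℝ) < (M + 1 - β : ℕ) := by exact_mod_cast (show β < M + 1 - β by omega)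
    linarith
  have h4 := H.theta_lt_eta β
  obtain ⟨d, hd⟩ := H.exists_gap_right (p := eta M q β) (by linarith) (by linarith)
    (H.eta_notMem hβ hβM) fun j _ _ => by
      rcases Nat.lt_or_ge β j with h | h
      · exact Or.inl (H.eta_lt_theta h)
      · right
        apply H.le_of_mul
        rw [H.mul_eta, H.mul_eta]
        have : (j : ℝ) ≤ β := by exact_mod_cast h
        linarith
  exact ⟨_, d, hd, by linarith [hd.1.1], h3⟩

/-- The image of a gap `(a_i, b_l)` contains a vertex that is in `tildeGraphOne`, or leads to it
in one step, or again starts at a point `a_m`, with `m = i + 1`; this cannot go on beyond `a_N`. -/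
theorem reachesOne_aPt : ∀ n i, 1 ≤ i → i < N → N - i ≤ n → ∀ d,
    IsInnerGap q b N (aPt q b i) d → ReachesOne q b N (aPt q b i) d := by
  intro n
  induction n with
  | zero => intro i _ _ _; omega
  | succ n ih =>
    intro i hi hiN hn d h
    obtain ⟨k, hk⟩ := H.exists_digit h
    have hqlt := mul_lt_mul_of_pos_left h.1.1 H.pos
    have hia := H.aPt_image hi hiN hk.2.1 (by linarith [hk.2.2])
    rcases H.right_cases h hk with ⟨j, -, -, -, h4⟩ | ⟨l, h1, h2, rfl, h4⟩ | ⟨l, h1, h2, rfl, -⟩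
    · exact H.reachesOne_theta h hk h4
    · obtain ⟨c', d', hg, hg1, hg2⟩ := H.exists_gap_in_image hi hiN h1 h2 h.1.1 hia h4
      have hpath := H.path_of_overlap h hg hk (hia ▸ hg1) (h4 ▸ hg2)
      suffices hs : ReachesOne q b N c' d' ∨ ReachesOne q b N (aPt q b i) (bPt q b l) by
        rcases hs with ⟨c'', d'', h5, h6, h7⟩ | hs
        · exact ⟨c'', d'', h5, h6, hpath.trans h7⟩
        · exact hs
      obtain ⟨k', hk'⟩ := H.exists_digit hg
      rcases H.left_cases hg hk' with
        ⟨j, -, -, -, h8⟩ | ⟨m, h5, h6, rfl, -⟩ | ⟨m, h5, h6, rfl, -⟩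
      · exact Or.inl (H.reachesOne_eta hg hk' h8)
      · have hge := hg.1.ge_of_lt (aPt_notMem (i := i + 1) (by omega) (by omega)) hg1
        rcases hge.eq_or_lt with heq | hlt
        · rcases Nat.lt_or_ge (i + 1) N with hi' | hi'
          · left
            rw [← heq] at hg ⊢
            exact ih (i + 1) (by omega) hi' (by omega) d' hg
          · -- The point `a_N = θ_β` lies in the switch region: no gap starts there.
            exfalso
            obtain rfl : N = i + 1 := by omega
            rw [← heq, H.aPt_N] at hg
            have := H.theta_lt_eta (b (i + 1 - 1) : ℕ)
            rcases left_outside hg H.one_le_last (digit_le _) with h' | h' <;> linarith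
        · right
          obtain ⟨e, he⟩ := H.exists_gap_aPt h5 h6.le
          exact ⟨_, _, he, isOne_aPt h5 h6.le e,
            H.path_of_overlap h he hk (hia ▸ hlt) (by rw [h4]; exact he.1.1.trans hg2)⟩
      · exact Or.inl ⟨_, _, hg, isOne_bPt h5 h6.le d', Relation.ReflTransGen.refl⟩
    · exact ⟨_, _, h, isOne_aPt h1 h2.le _, Relation.ReflTransGen.refl⟩

theorem reachesOne {c d : ℝ} (h : IsInnerGap q b N c d) : ReachesOne q b N c d := by
  obtain ⟨k, hk⟩ := H.exists_digit h
  rcases H.left_cases h hk with ⟨j, -, -, -, h4⟩ | ⟨i, h1, h2, rfl, -⟩ | ⟨i, h1, h2, rfl, -⟩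
  · exact H.reachesOne_eta h hk h4
  · exact H.reachesOne_aPt (N - i) i h1 h2 le_rfl d h
  · exact ⟨_, _, h, isOne_bPt h1 h2.le d, Relation.ReflTransGen.refl⟩

/-! ### The criterion for strong connectivity -/

/-- If the vertices of the two special forms are reachable from `tildeGraphOne`, so are all the
others: these start at some `η_j` and end at some `b_i`, so their reflections end at
`θ_{M + 1 - j}`. -/
theorem exists_path_from_one
    (hyp : ∀ J ∈ (tildeGraph q b N).verts, (IsABInterval q b N J ∨ IsThetaInterval M q J) →
      ∃ I ∈ (tildeGraphOne q b N).verts, (tildeGraph q b N).HasPath I J)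
    {c d : ℝ} (h : IsInnerGap q b N c d) :
    ∃ I ∈ (tildeGraphOne q b N).verts, (tildeGraph q b N).HasPath I (Set.Ioo c d) := by
  have hJ : Set.Ioo c d ∈ (tildeGraph q b N).verts := H.mem_verts.mpr ⟨c, d, h, rfl⟩
  obtain ⟨k, hk⟩ := H.exists_digit h
  rcases H.right_cases h hk with ⟨j, h1, h2, rfl, -⟩ | ⟨l, h1, h2, rfl, -⟩ | ⟨l, h1, h2, rfl, -⟩
  · exact hyp _ hJ (Or.inr ⟨j, ⟨h1, h2⟩, c, rfl⟩)
  · rcases H.left_cases h hk with ⟨j, h3, h4, rfl, -⟩ | ⟨i, h3, h4, rfl, -⟩ | ⟨i, h3, h4, rfl, -⟩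
    · have hr := H.reflect_gap h
      obtain ⟨I, hI, hp⟩ := hyp _ (H.mem_verts.mpr ⟨_, _, hr, rfl⟩)
        (Or.inr ⟨M + 1 - j, ⟨by omega, by omega⟩, _, by rw [H.bound_sub_eta h4]⟩)
      have hp' := H.reflect_path hp
      rw [reflect_Ioo, sub_sub_cancel, sub_sub_cancel] at hp'
      obtain ⟨u, v, h5, h6, rfl⟩ := H.mem_verts_one.mp hI
      refine ⟨_, H.mem_verts_one.mpr ⟨_, _, H.reflect_gap h5, reflect_one h6, ?_⟩, hp'⟩
      rw [reflect_Ioo]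
    · exact hyp _ hJ (Or.inl ⟨i, ⟨h3, h4.le⟩, l, ⟨h1, h2.le⟩, rfl⟩)
    · exact ⟨_, H.mem_verts_one.mpr ⟨_, _, h, isOne_bPt h3 h4.le _, rfl⟩,
        Relation.ReflTransGen.refl⟩
  · exact ⟨_, H.mem_verts_one.mpr ⟨_, _, h, isOne_aPt h1 h2.le _, rfl⟩, Relation.ReflTransGen.refl⟩

theorem stronglyConnected_iff : (tildeGraph q b N).StronglyConnected ↔
    ∀ J ∈ (tildeGraph q b N).verts, (IsABInterval q b N J ∨ IsThetaInterval M q J) →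
      ∃ I ∈ (tildeGraphOne q b N).verts, (tildeGraph q b N).HasPath I J := by
  constructor
  · intro hsc J hJ _
    obtain ⟨c, hc⟩ := H.exists_gap_aPt le_rfl H.one_le_N
    exact ⟨_, H.mem_verts_one.mpr ⟨_, _, hc, isOne_aPt le_rfl H.one_le_N c, rfl⟩,
      hsc _ (H.mem_verts.mpr ⟨_, _, hc, rfl⟩) J hJ⟩
  · intro hyp I hI J hJ
    obtain ⟨c, d, h, rfl⟩ := H.mem_verts.mp hI
    obtain ⟨c', d', h', rfl⟩ := H.mem_verts.mp hJ
    obtain ⟨u, v, h1, h2, h3⟩ := H.reachesOne h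
    obtain ⟨K, hK, h4⟩ := H.exists_path_from_one hyp h'
    exact h3.trans ((hasPath_of_one (H.stronglyConnected_one _
      (H.mem_verts_one.mpr ⟨u, v, h1, h2, rfl⟩) K hK)).trans h4)

end IsFiniteGreedy

/-! ### Bases in the closure of the univoque bases -/

theorem orbitDigit_eq_zero {N : ℕ} (hN : greedyOrbit M q 1 N = 0) {k : ℕ} (hk : N ≤ k) :
    orbitDigit M q k = 0 ∧ greedyOrbit M q 1 k = 0 := by
  have hd : ∀ k, greedyOrbit M q 1 k = 0 → orbitDigit M q k = 0 := by
    intro k h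
    apply Fin.ext
    simp [orbitDigit, greedyDigit, h]
  induction k, hk using Nat.le_induction with
  | base => exact ⟨hd N hN, hN⟩
  | succ k _ ih =>
    have h : greedyOrbit M q 1 (k + 1) = 0 := by rw [orbit_succ, ih.1, ih.2]; simp
    exact ⟨hd _ h, h⟩

theorem aPt_orbitDigit (hq : 1 < q) (hqM : q < M + 1) (i : ℕ) :
    aPt q (orbitDigit M q) i = greedyOrbit M q 1 (i - 1) :=
  value_orbitDigit hq hqM (i - 1)

theorem exists_isFiniteGreedy (hM : 1 ≤ M)
    (hq : q ∈ closure (univoqueBases M) \ univoqueBases M) :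
    ∃ N, HasLastDigit (orbitDigit M q) N ∧ IsFiniteGreedy q (orbitDigit M q) N := by
  obtain ⟨hq1, hqM⟩ := bounds_of_mem_closure_diff hM hq
  obtain ⟨N, hN1, hN, hgt⟩ := exists_orbit_eq_zero_and_lt hM hq
  have ha := aPt_orbitDigit hq1 hqM
  have H : IsFiniteGreedy q (orbitDigit M q) N :=
    { one_lt := hq1
      lt_add_one := hqM
      one_le_N := hN1
      aPt_one := ha 1
      aPt_succ := fun i hi _ => by
        rw [ha, ha, Nat.add_sub_cancel, ← orbit_succ, Nat.sub_add_cancel hi]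
      aPt_last := by
        have := orbit_succ M q (N - 1)
        rw [Nat.sub_add_cancel hN1, hN] at this
        rw [ha]
        linarith
      aPt_lt := fun i hi _ => by rw [ha]; exact orbit_lt_one hq1 hqM (by omega)
      lt_aPt := fun i _ hi => by rw [ha]; exact hgt _ (by omega) }
  refine ⟨N, ⟨hN1, fun h => ?_, fun k hk => (orbitDigit_eq_zero hN hk).1⟩, H⟩
  have := H.one_le_last
  rw [h] at this
  simp at this

end Univoque

theorem proposition12p1 (M : ℕ) (hM : 1 ≤ M) (q : ℝ)
    (hq : q ∈ closure (Univoque.univoqueBases M) \ Univoque.univoqueBases M) :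
    ∃ (b : ℕ → Fin (M + 1)) (N : ℕ),
      Univoque.IsGreedyExpansion q 1 b ∧ Univoque.HasLastDigit b N ∧
      (Univoque.tildeGraphOne q b N).StronglyConnected ∧
      ((Univoque.tildeGraph q b N).StronglyConnected ↔
        ∀ J ∈ (Univoque.tildeGraph q b N).verts,
          (Univoque.IsABInterval q b N J ∨ Univoque.IsThetaInterval M q J) →
            ∃ I ∈ (Univoque.tildeGraphOne q b N).verts,
              (Univoque.tildeGraph q b N).HasPath I J) := by
  obtain ⟨N, hlast, H⟩ := Univoque.exists_isFiniteGreedy hM hq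
  obtain ⟨hq1, hqM⟩ := Univoque.bounds_of_mem_closure_diff hM hq
  exact ⟨Univoque.orbitDigit M q, N, Univoque.isGreedyExpansion_orbitDigit hq1 hqM, hlast,
    H.stronglyConnected_one, H.stronglyConnected_iff⟩
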